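/- Let $\ell>0$ and let $\Gamma:[0,\ell]\to\mathbb{R}^3$ be a $C^2$ embedded curve (injective, with endpoints) parametrized by arclength. For $r\ge 0$ let $N_r(\Gamma)=\bigcup_{s\in[0,\ell]}\{p:\langle p-\Gamma(s),\Gamma'(s)\rangle=0,\ |p-\Gamma(s)|\le r\}$ be the normal tubular neighborhood of $\Gamma$, the union of its closed normal discs of radius $r$, and let $T_r(\Gamma)=\{p:\operatorname{dist}(p,\Gamma([0,\ell]))\le r\}$ be the metric tubular neighborhood. Let $\Delta\subset\mathbb{R}^2$ be the closed unit disc and $\Delta^o$ its interior. There are constants $C_1,C_2,\varepsilon>0$ and a function $\omega:\mathbb{R}\to\mathbb{R}$ with $\omega(\alpha)=o(\alpha^{2/3})$ as $\alpha\to0^+$, all depending only on $\Gamma$, such that the following holds. Let $r_1\ge 0$ and $\alpha>0$, and put $$r_2=C_1r_1+C_2\,\alpha^{2/3}+\omega(\alpha).$$ Let $X\in H^1(\Delta^o,\mathbb{R}^3)\cap C^0(\Delta,\mathbb{R}^3)$ be harmonic and conformal in $\Delta^o$, that is, $\Delta X=0$, $\langle X_x,X_y\rangle=0$ and $|X_x|=|X_y|$,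 with Dirichlet energy $D(X)=\frac12\int_{\Delta^o}|X_x|^2+|X_y|^2\,dx\,dy\le\alpha$. 1. If $r_1\le\varepsilon$, $\alpha\le\varepsilon$ and $X(\partial\Delta)\subset N_{r_1}(\Gamma)$, then $X(\Delta)\subset N_{r_2}(\Gamma)$. 2. Without any smallness assumption on $r_1$ or $\alpha$: if $X(\partial\Delta)\subset T_{r_1}(\Gamma)$, then $X(\Delta)\subset T_{r_2}(\Gamma)$. -/

import Mathlib

open Set Metric MeasureTheory Filter Topology

/-- Euclidean three-space. -/
abbrev Space3 : Type := EuclideanSpace ℝ (Fin 3)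

/-- The partial derivative of `X` in the first real coordinate of the plane `ℂ = ℝ²`. -/
noncomputable def partialX (X : ℂ → Space3) (z : ℂ) : Space3 := fderiv ℝ X z 1

/-- The partial derivative of `X` in the second real coordinate of the plane `ℂ = ℝ²`. -/
noncomputable def partialY (X : ℂ → Space3) (z : ℂ) : Space3 := fderiv ℝ X z Complex.I

/-- The Dirichlet energy `½ ∫ |X_x|² + |X_y|²` over the open unit disc, as an extended
nonnegative real (it is used only for maps that are `C²` in the open disc). -/
noncomputable def dirichletEnergy (X : ℂ → Space3) : ENNReal :=
  2⁻¹ * ∫⁻ z in ball (0 : ℂ) 1, ENNReal.ofReal (‖partialX X z‖ ^ 2 + ‖partialY X z‖ ^ 2)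

/-- `X` is a conformal harmonic map of the disc of class `H¹ ∩ C⁰`: continuous on the closed
unit disc, harmonic and (weakly) conformal in the open unit disc, of finite Dirichlet energy. -/
structure IsConformalHarmonicDisc (X : ℂ → Space3) : Prop where
  continuousOn : ContinuousOn X (closedBall 0 1)
  harmonic : InnerProductSpace.HarmonicOnNhd X (ball 0 1)
  inner_eq_zero : ∀ z ∈ ball (0 : ℂ) 1, inner ℝ (partialX X z) (partialY X z) = 0
  norm_eq : ∀ z ∈ ball (0 : ℂ) 1, ‖partialX X z‖ = ‖partialY X z‖
  finite_energy : dirichletEnergy X < ⊤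

/-- `Γ` restricted to `[0, ℓ]` is a `C²` embedded curve of length `ℓ > 0`, parametrized by
arclength (with one-sided derivatives at the end points). -/
structure IsArclengthEmbeddedC2 (ℓ : ℝ) (Γ : ℝ → Space3) : Prop where
  length_pos : 0 < ℓ
  contDiffOn : ContDiffOn ℝ 2 Γ (Icc 0 ℓ)
  unit_speed : ∀ s ∈ Icc 0 ℓ, ‖derivWithin Γ (Icc 0 ℓ) s‖ = 1
  injOn : InjOn Γ (Icc 0 ℓ)

/-- The closed disc of radius `r` with centre `Γ s` in the plane normal to `Γ` at `Γ s`. -/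
def normalDisc (ℓ : ℝ) (Γ : ℝ → Space3) (r s : ℝ) : Set Space3 :=
  {p | inner ℝ (p - Γ s) (derivWithin Γ (Icc 0 ℓ) s) = 0 ∧ ‖p - Γ s‖ ≤ r}

/-- The normal `r`-neighborhood of `Γ`: the union of its normal discs of radius `r`. -/
def normalTube (ℓ : ℝ) (Γ : ℝ → Space3) (r : ℝ) : Set Space3 :=
  ⋃ s ∈ Icc 0 ℓ, normalDisc ℓ Γ r s

/-- The metric `r`-neighborhood of `Γ`: the points at distance at most `r` from the curve. -/
def metricTube (ℓ : ℝ) (Γ : ℝ → Space3) (r : ℝ) : Set Space3 :=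
  cthickening r (Γ '' Icc 0 ℓ)

/-! Suppose `X z₀` has distance `d` from the curve and `q` is a nearest point. With `e = X z₀ - q`,
the height `⟨e, X - q⟩` is harmonic and equals `d²` at `z₀`. Up to distance `L ~ √d` the curve rises
in direction `e` by at most order `L² ~ d`, so, if `r₁` is at most `d/8`, nearby boundary values
have height at most `d²/4`. A maximum principle with an obstacle (`exists_ge_of_harmonic`) then
yields points of height at least `d²` at every distance `k d/2 ≤ L` from `X z₀`. About `L/d` of them
carry disjoint balls of radius `d/4` that avoid the boundary values. By monotonicity each ball
contains area of order `d²`, so the energy is at least of order `L d ~ d^(3/2)`, whence `d ≤ C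
α^(2/3)` (`dist_pow_three_le`). Continuity and a diameter bound remove the smallness assumptions
(`exists_infDist_le`).

For normal tubes, a point of the metric tube can fail to be in the normal tube only beyond an end
plane. The same maximum principle, applied to the height over that plane, excludes this
(`exists_halfSpace`). -/

/-! ### Maximum principles -/

/-- Locally `u = Re F` with `F` holomorphic, and the maximum modulus principle applies to `exp F`,
whose modulus is `exp u`. -/
theorem InnerProductSpace.HarmonicAt.eventually_eq_of_isLocalMax {u : ℂ → ℝ} {z : ℂ}
    (hu : InnerProductSpace.HarmonicAt u z) (hmax : IsLocalMax u z) :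
    ∀ᶠ w in 𝓝 z, u w = u z := by
  obtain ⟨r, hr, hball⟩ := Metric.eventually_nhds_iff_ball.1 hu.eventually
  obtain ⟨F, hF, hFu⟩ :=
    InnerProductSpace.HarmonicOnNhd.exists_analyticOnNhd_ball_re_eq (f := u) (z := z) (R := r) hball
  have hmem : ball z r ∈ 𝓝 z := ball_mem_nhds z hr
  have hz : z ∈ ball z r := mem_ball_self hr
  have hmax' : IsLocalMax (norm ∘ fun w => Complex.exp (F w)) z := by
    filter_upwards [hmem, hmax] with w hw hle
    have h1 := hFu hw
    have h2 := hFu hz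
    simp only [Function.comp, Complex.norm_exp] at *
    rw [h1, h2]
    exact Real.exp_le_exp.2 hle
  have hd : ∀ᶠ w in 𝓝 z, DifferentiableAt ℂ (fun w => Complex.exp (F w)) w := by
    filter_upwards [hmem] with w hw
    exact (hF w hw).differentiableAt.cexp
  filter_upwards [Complex.eventually_eq_of_isLocalMax_norm hd hmax', hmem] with w hw hwb
  have h1 := hFu hwb
  have h2 := hFu hz
  have h3 := congrArg norm hw
  simp only [Complex.norm_exp, Real.exp_eq_exp] at h1 h2 h3
  linarith

/-- A maximum principle with an obstacle: starting at `z₀`, a harmonic function can be followed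
without decreasing it until `g` reaches the level `t` or the boundary of the disc is hit. -/
theorem exists_ge_of_harmonic {u g : ℂ → ℝ} {t : ℝ} {z₀ : ℂ}
    (huc : ContinuousOn u (closedBall 0 1)) (hgc : ContinuousOn g (closedBall 0 1))
    (hu : InnerProductSpace.HarmonicOnNhd u (ball 0 1))
    (hz₀ : z₀ ∈ closedBall (0 : ℂ) 1) (hg₀ : g z₀ ≤ t) :
    ∃ z ∈ closedBall (0 : ℂ) 1, u z₀ ≤ u z ∧ g z ≤ t ∧ (g z = t ∨ z ∈ sphere (0 : ℂ) 1) := by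
  have hK : IsCompact (closedBall (0 : ℂ) 1 ∩ g ⁻¹' Iic t) :=
    (isCompact_closedBall 0 1).of_isClosed_subset
      (hgc.preimage_isClosed_of_isClosed isClosed_closedBall isClosed_Iic) inter_subset_left
  obtain ⟨m, ⟨hmb, hmt⟩, hmax⟩ := hK.exists_isMaxOn ⟨z₀, hz₀, hg₀⟩ (huc.mono inter_subset_left)
  -- Otherwise every maximum point in the sublevel set is interior with `g < t`, so the maximum set
  -- is open and closed in the connected disc. It then contains the boundary point `1`, a
  -- contradiction.
  by_contra! hcon
  have hum : u z₀ ≤ u m := hmax ⟨hz₀, hg₀⟩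
  have hint : ∀ z ∈ closedBall (0 : ℂ) 1, g z ≤ t → u z = u m → ∀ᶠ w in 𝓝 z, g w ≤ t ∧ u w = u m := by
    intro z hz hgz huz
    obtain ⟨h1, h2⟩ := hcon z hz (hum.trans huz.ge) hgz
    have hzb : z ∈ ball (0 : ℂ) 1 := by
      rw [mem_ball]
      exact lt_of_le_of_ne hz h2
    have hnb : ball (0 : ℂ) 1 ∈ 𝓝 z := isOpen_ball.mem_nhds hzb
    have hgz' : ∀ᶠ w in 𝓝 z, g w < t :=
      ((hgc.mono ball_subset_closedBall).continuousAt hnb).eventually_lt_const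
        (lt_of_le_of_ne hgz h1)
    have hloc : IsLocalMax u z := by
      filter_upwards [hgz', hnb] with w hw hwb
      rw [huz]
      exact hmax ⟨ball_subset_closedBall hwb, hw.le⟩
    filter_upwards [hgz', (hu z hzb).eventually_eq_of_isLocalMax hloc] with w hw hw'
    exact ⟨hw.le, hw'.trans huz⟩
  have hpre : IsPreconnected (closedBall (0 : ℂ) 1) := (convex_closedBall 0 1).isPreconnected
  set S : Set ℂ := {z | ∀ᶠ w in 𝓝 z, g w ≤ t ∧ u w = u m} with hS
  have hSo : IsOpen S := by
    rw [isOpen_iff_mem_nhds]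
    intro z hz
    exact eventually_eventually_nhds.2 hz
  have hT : IsClosed (closedBall (0 : ℂ) 1 ∩ g ⁻¹' Iic t ∩ (closedBall (0 : ℂ) 1 ∩ u ⁻¹' {u m})) :=
    (hgc.preimage_isClosed_of_isClosed isClosed_closedBall isClosed_Iic).inter
      (huc.preimage_isClosed_of_isClosed isClosed_closedBall isClosed_singleton)
  have hall : closedBall (0 : ℂ) 1 ⊆ S := by
    by_contra hnot
    obtain ⟨y, hy, hyS⟩ := not_subset.1 hnot
    obtain ⟨x, hx, hx1, hx2⟩ := hpre S _ hSo hT.isOpen_compl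
      (fun z hz => by
        by_cases hzS : z ∈ S
        · exact Or.inl hzS
        · refine Or.inr fun hzT => hzS (hint z hz hzT.1.2 hzT.2.2))
      ⟨m, hmb, hint m hmb hmt rfl⟩
      ⟨y, hy, fun hyT => hyS (hint y hy hyT.1.2 hyT.2.2)⟩
    have := hx1.self_of_nhds
    exact hx2 ⟨⟨hx, this.1⟩, hx, this.2⟩
  have h1 : (1 : ℂ) ∈ closedBall (0 : ℂ) 1 := by simp
  have h2 := (hall h1).self_of_nhds
  exact (hcon 1 h1 (hum.trans h2.2.ge) h2.1).2 (by simp)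

/-! ### Coordinate functions and unique continuation -/

namespace IsConformalHarmonicDisc

variable {X : ℂ → Space3}

theorem contDiffAt (hX : IsConformalHarmonicDisc X) {z : ℂ} (hz : z ∈ ball (0 : ℂ) 1) :
    ContDiffAt ℝ 2 X z := (hX.harmonic z hz).1

theorem harmonicOnNhd_inner (hX : IsConformalHarmonicDisc X) (q n : Space3) :
    InnerProductSpace.HarmonicOnNhd (fun z => inner ℝ n (X z - q)) (ball 0 1) := by
  have h := (hX.harmonic.comp_CLM (innerSL ℝ n)).sub
    (InnerProductSpace.harmonicOnNhd_const (inner ℝ n q))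
  convert h using 1
  ext z
  simp [inner_sub_right]

theorem continuousOn_inner (hX : IsConformalHarmonicDisc X) (q n : Space3) :
    ContinuousOn (fun z => inner ℝ n (X z - q)) (closedBall 0 1) :=
  continuousOn_const.inner (hX.continuousOn.sub continuousOn_const)

theorem continuousOn_norm_sub (hX : IsConformalHarmonicDisc X) (q : Space3) :
    ContinuousOn (fun z => ‖X z - q‖) (closedBall 0 1) :=
  (hX.continuousOn.sub continuousOn_const).norm

/-- A conformal harmonic disc that is constant near an interior point is constant. -/
theorem eqOn_const (hX : IsConformalHarmonicDisc X) {z : ℂ} {p : Space3}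
    (hz : z ∈ ball (0 : ℂ) 1) (h : ∀ᶠ w in 𝓝 z, X w = p) :
    ∀ w ∈ closedBall (0 : ℂ) 1, X w = p := by
  have hball : ∀ w ∈ ball (0 : ℂ) 1, X w = p := by
    intro w hw
    have key : ∀ n : Space3, inner ℝ n (X w - p) = 0 := by
      intro n
      have han : AnalyticOnNhd ℝ (fun z => inner ℝ n (X z - p)) (ball (0 : ℂ) 1) :=
        fun y hy => _root_.HarmonicAt.analyticAt (hX.harmonicOnNhd_inner p n y hy)
      refine han.eqOn_of_preconnected_of_eventuallyEq (g := fun _ => (0 : ℝ))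
        (fun _ _ => analyticAt_const) (convex_ball 0 1).isPreconnected hz ?_ hw
      filter_upwards [h] with y hy
      simp [hy]
    have := key (X w - p)
    exact sub_eq_zero.1 (inner_self_eq_zero.1 this)
  intro w hw
  have hcl : closedBall (0 : ℂ) 1 = closure (ball 0 1) := (closure_ball 0 one_ne_zero).symm
  refine Set.EqOn.of_subset_closure (s := ball (0 : ℂ) 1) (t := closedBall 0 1)
    (f := X) (g := fun _ => p) hball hX.continuousOn continuousOn_const
    ball_subset_closedBall hcl.le hw

end IsConformalHarmonicDisc

/-! ### First variation with a radial cut-off -/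

/-- The integral of a directional derivative of a compactly supported function vanishes. -/
theorem setIntegral_lineDeriv_eq_zero {U K : Set ℂ} (hU : IsOpen U) (hK : IsCompact K)
    (hKU : K ⊆ U) {y D : ℂ → ℝ} (v : ℂ)
    (hy : ∀ z ∈ U, HasLineDerivAt ℝ y (D z) z v) (hyc : ContinuousOn y U) (hD : ContinuousOn D U)
    (hy0 : ∀ z ∈ U, z ∉ K → y z = 0) (hD0 : ∀ z ∈ U, z ∉ K → D z = 0) :
    ∫ z in K, D z = 0 := by
  have hint : ∀ g : ℂ → ℝ, ContinuousOn g U → Integrable (K.indicator g) := fun g hg =>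
    ((hg.mono hKU).integrableOn_compact hK).integrable_indicator hK.measurableSet
  have hder : ∀ z, HasLineDerivAt ℝ (K.indicator y) (K.indicator D z) z v := by
    intro z
    by_cases hz : z ∈ U
    · have h1 : ∀ g : ℂ → ℝ, (∀ z ∈ U, z ∉ K → g z = 0) → ∀ w ∈ U, K.indicator g w = g w := by
        intro g hg w hw
        by_cases hwK : w ∈ K
        · exact indicator_of_mem hwK g
        · rw [indicator_of_notMem hwK, hg w hw hwK]
      rw [h1 D hD0 z hz]
      refine (hy z hz).congr_of_eventuallyEq ?_
      filter_upwards [hU.mem_nhds hz] with w hw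
      exact h1 y hy0 w hw
    · have hzK : z ∉ K := fun h => hz (hKU h)
      rw [indicator_of_notMem hzK]
      have h0 : HasLineDerivAt ℝ (fun _ : ℂ => (0 : ℝ)) 0 z v :=
        ((hasFDerivAt_const (0 : ℝ) z).hasLineDerivAt v)
      refine h0.congr_of_eventuallyEq ?_
      filter_upwards [hK.isClosed.isOpen_compl.mem_nhds hzK] with w hw
      exact indicator_of_notMem hw y
  -- Integration by parts of the extension by zero against the constant function `1`.
  have h := integral_bilinear_hasLineDerivAt_right_eq_neg_left_of_integrable
    (μ := (volume : Measure ℂ)) (f := fun _ => (1 : ℝ)) (f' := fun _ => 0) (g := K.indicator y)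
    (g' := K.indicator D) (v := v) (B := ContinuousLinearMap.mul ℝ ℝ)
    (by simp) (by simpa using hint D hD) (by simpa using hint y hyc)
    (fun x _ => (hasFDerivAt_const (1 : ℝ) x).hasLineDerivAt v) (fun x _ => hder x)
  simpa [integral_indicator hK.measurableSet] using h

/-- Bessel's inequality without normalization, so that branch points (`a = b = 0`) are included:
Cauchy–Schwarz for `w` and `⟨w,a⟩a + ⟨w,b⟩b`. -/
theorem inner_sq_add_inner_sq_le {E : Type*} [NormedAddCommGroup E] [InnerProductSpace ℝ E]
    {a b w : E} (hab : inner ℝ a b = 0) (hn : ‖a‖ = ‖b‖) :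
    (inner ℝ w a) ^ 2 + (inner ℝ w b) ^ 2 ≤ ‖w‖ ^ 2 * ‖a‖ ^ 2 := by
  set s := inner ℝ w a with hs
  set t := inner ℝ w b with ht
  have h1 : inner ℝ w (s • a + t • b) = s ^ 2 + t ^ 2 := by
    rw [inner_add_right, inner_smul_right, inner_smul_right]; ring
  have h2 : ‖s • a + t • b‖ ^ 2 = (s ^ 2 + t ^ 2) * ‖a‖ ^ 2 := by
    rw [norm_add_sq_real, inner_smul_left, inner_smul_right, hab, norm_smul, norm_smul, ← hn]
    simp only [mul_pow, Real.norm_eq_abs, sq_abs]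
    simp
    ring
  have h3 := abs_real_inner_le_norm w (s • a + t • b)
  rw [h1] at h3
  have h4 : (s ^ 2 + t ^ 2) ^ 2 ≤ ‖w‖ ^ 2 * ((s ^ 2 + t ^ 2) * ‖a‖ ^ 2) := by
    rw [← h2, ← mul_pow, ← sq_abs (s ^ 2 + t ^ 2)]
    exact pow_le_pow_left₀ (abs_nonneg _) h3 2
  by_contra! hlt
  have h5 : 0 < s ^ 2 + t ^ 2 := lt_of_le_of_lt (by positivity) hlt
  nlinarith

theorem hasDerivAt_max_zero_sq (x : ℝ) :
    HasDerivAt (fun x : ℝ => (max 0 x) ^ 2) (2 * max 0 x) x := by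
  rcases lt_trichotomy x 0 with hx | rfl | hx
  · rw [max_eq_left hx.le, mul_zero]
    refine (hasDerivAt_const x (0 : ℝ)).congr_of_eventuallyEq ?_
    filter_upwards [Iio_mem_nhds hx] with y hy
    rw [max_eq_left (le_of_lt hy)]; norm_num
  · rw [hasDerivAt_iff_isLittleO]
    refine Asymptotics.IsBigO.trans_isLittleO (g := fun x : ℝ => x ^ 2) ?_ ?_
    · refine Asymptotics.IsBigO.of_bound 1 (Eventually.of_forall fun y => ?_)
      simp only [max_self, sub_zero, mul_zero, smul_zero, Real.norm_eq_abs, abs_pow, sq_abs]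
      rcases le_total y 0 with h | h
      · rw [max_eq_left h]; norm_num; positivity
      · rw [max_eq_right h]; simp
    · simpa using Asymptotics.isLittleO_pow_id (𝕜 := ℝ) (n := 2) (by norm_num)
  · rw [max_eq_right hx.le]
    have h := hasDerivAt_pow 2 x
    norm_num at h
    refine h.congr_of_eventuallyEq ?_
    filter_upwards [Ioi_mem_nhds hx] with y hy
    rw [max_eq_right (le_of_lt hy)]

/-- A cut-off `h` for which `s h(s)` increases strongly near `0` and decreases slowly. -/
theorem exists_radial_cutoff {R ρ : ℝ} (hR : 0 < R) (hρ : 0 < ρ) (hρR : ρ ≤ R ^ 2 / 2) :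
    ∃ h h' : ℝ → ℝ, (∀ s, 0 ≤ s → HasDerivAt h (h' s) s) ∧ ContinuousOn h' (Ici 0) ∧
      (∀ s, R ^ 2 ≤ s → h s = 0 ∧ h' s = 0) ∧ (∀ s, 0 ≤ s → h' s ≤ 0) ∧
      (∀ s, 0 ≤ s → -(2 / R ^ 2) ≤ h s + s * h' s) ∧
      (∀ s, 0 ≤ s → s ≤ ρ → 1 / (16 * ρ) - 2 / R ^ 2 ≤ h s + s * h' s) := by
  have hR2 : 0 < R ^ 2 := by positivity
  -- The cut-off is `h = m²/(s + ρ)` with `m = (1 - s/R²)₊`, a regularization of `1/s`; squaring `m`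
  -- makes it `C¹`. This identity computes `(s h)'`. Its first term is at least `1/(16ρ)` for `s ≤
  -- ρ`, where `m ≥ 1/2`.
  have hval : ∀ s, 0 ≤ s → ∀ m : ℝ, m ^ 2 / (s + ρ) +
      s * ((2 * m * -(1 / R ^ 2) * (s + ρ) - m ^ 2) / (s + ρ) ^ 2) =
      m ^ 2 * (ρ / (s + ρ) ^ 2) - 2 / R ^ 2 * (m * (s / (s + ρ))) := by
    intro s hs m
    have : s + ρ ≠ 0 := by positivity
    field_simp
    ring
  have hms : ∀ s, 0 ≤ s → 0 ≤ max 0 (1 - s / R ^ 2) ∧ max 0 (1 - s / R ^ 2) * (s / (s + ρ)) ≤ 1 := by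
    intro s hs
    have h1 : max 0 (1 - s / R ^ 2) ≤ 1 := max_le zero_le_one (by
      have : 0 ≤ s / R ^ 2 := by positivity
      linarith)
    have h2 : s / (s + ρ) ≤ 1 := (div_le_one (by positivity)).2 (by linarith)
    exact ⟨le_max_left _ _, mul_le_one₀ h1 (by positivity) h2⟩
  refine ⟨fun s => (max 0 (1 - s / R ^ 2)) ^ 2 / (s + ρ),
    fun s => (2 * max 0 (1 - s / R ^ 2) * -(1 / R ^ 2) * (s + ρ) - (max 0 (1 - s / R ^ 2)) ^ 2)
      / (s + ρ) ^ 2, ?_, ?_, ?_, ?_, ?_, ?_⟩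
  · intro s hs
    have h1 : HasDerivAt (fun s : ℝ => 1 - s / R ^ 2) (-(1 / R ^ 2)) s := by
      simpa using ((hasDerivAt_id s).div_const (R ^ 2)).const_sub 1
    have h2 := (hasDerivAt_max_zero_sq (1 - s / R ^ 2)).comp s h1
    have h3 := h2.div ((hasDerivAt_id s).add_const ρ) (by simp; positivity)
    refine HasDerivAt.congr_deriv h3 ?_
    simp
  · refine ContinuousOn.div (by fun_prop) (by fun_prop) fun s hs => ?_
    have : (0 : ℝ) ≤ s := hs
    positivity
  · intro s hs
    have : max 0 (1 - s / R ^ 2) = 0 := max_eq_left (by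
      have := (one_le_div hR2).2 hs
      linarith)
    simp [this]
  · intro s hs
    have := (hms s hs).1
    refine div_nonpos_of_nonpos_of_nonneg ?_ (by positivity)
    have h4 : 0 ≤ 2 * max 0 (1 - s / R ^ 2) * (1 / R ^ 2) * (s + ρ) := by positivity
    nlinarith [sq_nonneg (max 0 (1 - s / R ^ 2))]
  · intro s hs
    rw [hval s hs]
    have h1 := mul_le_mul_of_nonneg_left (hms s hs).2 (show 0 ≤ 2 / R ^ 2 by positivity)
    have h2 : 0 ≤ (max 0 (1 - s / R ^ 2)) ^ 2 * (ρ / (s + ρ) ^ 2) := by positivity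
    linarith
  · intro s hs hsρ
    rw [hval s hs]
    have h1 := mul_le_mul_of_nonneg_left (hms s hs).2 (show 0 ≤ 2 / R ^ 2 by positivity)
    have h2 : 1 / 2 ≤ max 0 (1 - s / R ^ 2) := by
      refine le_max_of_le_right ?_
      have : s / R ^ 2 ≤ 1 / 2 := by rw [div_le_iff₀ hR2]; linarith
      linarith
    have h3 : 1 / 4 * (1 / (4 * ρ)) ≤ (max 0 (1 - s / R ^ 2)) ^ 2 * (ρ / (s + ρ) ^ 2) := by
      refine mul_le_mul (by nlinarith) ?_ (by positivity) (by positivity)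
      rw [div_le_div_iff₀ (by positivity) (by positivity)]
      nlinarith
    have h4 : 1 / 4 * (1 / (4 * ρ)) = 1 / (16 * ρ) := by field_simp; norm_num
    linarith

namespace IsConformalHarmonicDisc

variable {X : ℂ → Space3}

theorem continuousOn_fderiv (hX : IsConformalHarmonicDisc X) :
    ContinuousOn (fderiv ℝ X) (ball 0 1) :=
  hX.harmonic.contDiffOn.continuousOn_fderiv_of_isOpen isOpen_ball (by norm_num)

theorem continuousOn_fderiv_apply (hX : IsConformalHarmonicDisc X) (v : ℂ) :
    ContinuousOn (fun z => fderiv ℝ X z v) (ball 0 1) :=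
  hX.continuousOn_fderiv.clm_apply continuousOn_const

theorem contDiffOn_fderiv (hX : IsConformalHarmonicDisc X) :
    ContDiffOn ℝ 1 (fderiv ℝ X) (ball 0 1) :=
  hX.harmonic.contDiffOn.fderiv_of_isOpen isOpen_ball (by norm_num)

theorem continuousOn_fderiv_fderiv_apply (hX : IsConformalHarmonicDisc X) (v : ℂ) :
    ContinuousOn (fun z => fderiv ℝ (fderiv ℝ X) z v v) (ball 0 1) :=
  ((hX.contDiffOn_fderiv.continuousOn_fderiv_of_isOpen isOpen_ball le_rfl).clm_apply
    continuousOn_const).clm_apply continuousOn_const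

theorem fderiv_fderiv_add (hX : IsConformalHarmonicDisc X) {z : ℂ} (hz : z ∈ ball (0 : ℂ) 1) :
    fderiv ℝ (fderiv ℝ X) z 1 1 + fderiv ℝ (fderiv ℝ X) z Complex.I Complex.I = 0 := by
  have h := (hX.harmonic z hz).2.eq_of_nhds
  simpa [InnerProductSpace.laplacian_eq_iteratedFDeriv_complexPlane, iteratedFDeriv_two_apply]
    using h

/-- The part of the disc that is mapped into a closed ball away from the boundary values. -/
theorem isCompact_preimage (hX : IsConformalHarmonicDisc X) {R : ℝ} {p : Space3}
    (hb : ∀ w ∈ sphere (0 : ℂ) 1, R < ‖X w - p‖) :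
    IsCompact {z | z ∈ closedBall (0 : ℂ) 1 ∧ ‖X z - p‖ ≤ R} ∧
      {z | z ∈ closedBall (0 : ℂ) 1 ∧ ‖X z - p‖ ≤ R} ⊆ ball 0 1 := by
  constructor
  · exact (isCompact_closedBall 0 1).of_isClosed_subset
      ((hX.continuousOn_norm_sub p).preimage_isClosed_of_isClosed isClosed_closedBall isClosed_Iic)
      inter_subset_left
  · rintro z ⟨hz, hzR⟩
    rw [mem_ball]
    refine lt_of_le_of_ne hz fun h => ?_
    exact absurd hzR (not_le.2 (hb z h))

/-- The first variation formula for the radial fields `h(|X - p|²)(X - p)`. -/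
theorem setIntegral_first_variation (hX : IsConformalHarmonicDisc X) {R : ℝ} (hR : 0 < R)
    {p : Space3} (hb : ∀ w ∈ sphere (0 : ℂ) 1, R < ‖X w - p‖) {h h' : ℝ → ℝ}
    (hh : ∀ s, 0 ≤ s → HasDerivAt h (h' s) s) (hh' : ContinuousOn h' (Ici 0))
    (h0 : ∀ s, R ^ 2 ≤ s → h s = 0 ∧ h' s = 0) (v : ℂ) :
    ∫ z in {z | z ∈ closedBall (0 : ℂ) 1 ∧ ‖X z - p‖ ≤ R},
      (h' (‖X z - p‖ ^ 2) * (2 * (inner ℝ (X z - p) (fderiv ℝ X z v)) ^ 2) +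
        h (‖X z - p‖ ^ 2) * (‖fderiv ℝ X z v‖ ^ 2 +
          inner ℝ (X z - p) (fderiv ℝ (fderiv ℝ X) z v v))) = 0 := by
  obtain ⟨hK, hKU⟩ := hX.isCompact_preimage hb
  have hXc : ContinuousOn X (ball 0 1) := hX.continuousOn.mono ball_subset_closedBall
  have hf : ContinuousOn (fun z => ‖X z - p‖ ^ 2) (ball 0 1) :=
    ((hX.continuousOn_norm_sub p).mono ball_subset_closedBall).pow 2
  have hsub : ContinuousOn (fun z => X z - p) (ball 0 1) := hXc.sub continuousOn_const
  have hhc : ContinuousOn h (Ici 0) := fun s hs => (hh s hs).continuousAt.continuousWithinAt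
  have hhf : ContinuousOn (fun z => h (‖X z - p‖ ^ 2)) (ball 0 1) :=
    hhc.comp hf fun z _ => mem_Ici.2 (sq_nonneg _)
  have hhf' : ContinuousOn (fun z => h' (‖X z - p‖ ^ 2)) (ball 0 1) :=
    hh'.comp hf fun z _ => mem_Ici.2 (sq_nonneg _)
  have hin : ContinuousOn (fun z => inner ℝ (X z - p) (fderiv ℝ X z v)) (ball 0 1) :=
    hsub.inner (hX.continuousOn_fderiv_apply v)
  have hout : ∀ z ∈ ball (0 : ℂ) 1, z ∉ {z | z ∈ closedBall (0 : ℂ) 1 ∧ ‖X z - p‖ ≤ R} →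
      R ^ 2 ≤ ‖X z - p‖ ^ 2 := by
    intro z hz hzK
    have : R < ‖X z - p‖ := by
      by_contra! hle
      exact hzK ⟨ball_subset_closedBall hz, hle⟩
    exact pow_le_pow_left₀ hR.le this.le 2
  refine setIntegral_lineDeriv_eq_zero isOpen_ball hK hKU
    (y := fun z => h (‖X z - p‖ ^ 2) * inner ℝ (X z - p) (fderiv ℝ X z v)) v ?_ (hhf.mul hin)
    ((hhf'.mul (continuousOn_const.mul (hin.pow 2))).add (hhf.mul
      (((hX.continuousOn_fderiv_apply v).norm.pow 2).add
        (hsub.inner (hX.continuousOn_fderiv_fderiv_apply v))))) ?_ ?_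
  · intro z hz
    have d1 : HasFDerivAt (fun z => X z - p) (fderiv ℝ X z) z :=
      ((hX.contDiffAt hz).differentiableAt (by norm_num)).hasFDerivAt.sub_const p
    have d2 : HasFDerivAt (fderiv ℝ X) (fderiv ℝ (fderiv ℝ X) z) z :=
      ((hX.contDiffOn_fderiv.contDiffAt (isOpen_ball.mem_nhds hz)).differentiableAt
        (by norm_num)).hasFDerivAt
    have d3 : HasFDerivAt (fun z => fderiv ℝ X z v) _ z := d2.clm_apply (hasFDerivAt_const v z)
    have d4 := d1.norm_sq
    have d5 := (hh (‖X z - p‖ ^ 2) (sq_nonneg _)).comp_hasFDerivAt z d4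
    have d6 := (d5.mul (d1.inner ℝ d3)).hasLineDerivAt v
    refine Eq.mp (congrArg (fun D => HasLineDerivAt ℝ _ D z v) ?_) d6
    simp [inner_sub_left]
    ring
  · intro z hz hzK
    simp [(h0 _ (hout z hz hzK)).1]
  · intro z hz hzK
    simp [h0 _ (hout z hz hzK)]

/-- Add the first variation formulas for the directions `1` and `I`. Harmonicity cancels the second
derivatives; since `h' ≤ 0`, Bessel's inequality bounds the radial terms from below by `2 |X_x|² s
h'(s)`, `s = |X - p|²`. -/
theorem setIntegral_radial_nonpos (hX : IsConformalHarmonicDisc X) {R : ℝ} (hR : 0 < R)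
    {p : Space3} (hb : ∀ w ∈ sphere (0 : ℂ) 1, R < ‖X w - p‖) {h h' : ℝ → ℝ}
    (hh : ∀ s, 0 ≤ s → HasDerivAt h (h' s) s) (hh' : ContinuousOn h' (Ici 0))
    (h0 : ∀ s, R ^ 2 ≤ s → h s = 0 ∧ h' s = 0) (hneg : ∀ s, 0 ≤ s → h' s ≤ 0) :
    IntegrableOn (fun z => ‖partialX X z‖ ^ 2 *
        (h (‖X z - p‖ ^ 2) + ‖X z - p‖ ^ 2 * h' (‖X z - p‖ ^ 2)))
      {z | z ∈ closedBall (0 : ℂ) 1 ∧ ‖X z - p‖ ≤ R} ∧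
    ∫ z in {z | z ∈ closedBall (0 : ℂ) 1 ∧ ‖X z - p‖ ≤ R}, ‖partialX X z‖ ^ 2 *
        (h (‖X z - p‖ ^ 2) + ‖X z - p‖ ^ 2 * h' (‖X z - p‖ ^ 2)) ≤ 0 := by
  obtain ⟨hK, hKU⟩ := hX.isCompact_preimage hb
  have e1 := hX.setIntegral_first_variation hR hb hh hh' h0 1
  have e2 := hX.setIntegral_first_variation hR hb hh hh' h0 Complex.I
  have hXc : ContinuousOn X (ball 0 1) := hX.continuousOn.mono ball_subset_closedBall
  have hf : ContinuousOn (fun z => ‖X z - p‖ ^ 2) (ball 0 1) :=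
    ((hX.continuousOn_norm_sub p).mono ball_subset_closedBall).pow 2
  have hsub : ContinuousOn (fun z => X z - p) (ball 0 1) := hXc.sub continuousOn_const
  have hhc : ContinuousOn h (Ici 0) := fun s hs => (hh s hs).continuousAt.continuousWithinAt
  have hhf : ContinuousOn (fun z => h (‖X z - p‖ ^ 2)) (ball 0 1) :=
    hhc.comp hf fun z _ => mem_Ici.2 (sq_nonneg _)
  have hhf' : ContinuousOn (fun z => h' (‖X z - p‖ ^ 2)) (ball 0 1) :=
    hh'.comp hf fun z _ => mem_Ici.2 (sq_nonneg _)
  have hvar : ∀ v, IntegrableOn (fun z =>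
      (h' (‖X z - p‖ ^ 2) * (2 * (inner ℝ (X z - p) (fderiv ℝ X z v)) ^ 2) +
        h (‖X z - p‖ ^ 2) * (‖fderiv ℝ X z v‖ ^ 2 +
          inner ℝ (X z - p) (fderiv ℝ (fderiv ℝ X) z v v))))
      {z | z ∈ closedBall (0 : ℂ) 1 ∧ ‖X z - p‖ ≤ R} := fun v =>
    (((hhf'.mul (continuousOn_const.mul ((hsub.inner (hX.continuousOn_fderiv_apply v)).pow 2))).add
      (hhf.mul (((hX.continuousOn_fderiv_apply v).norm.pow 2).add
        (hsub.inner (hX.continuousOn_fderiv_fderiv_apply v))))).mono hKU).integrableOn_compact hK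
  have hint : IntegrableOn (fun z => ‖partialX X z‖ ^ 2 *
        (h (‖X z - p‖ ^ 2) + ‖X z - p‖ ^ 2 * h' (‖X z - p‖ ^ 2)))
      {z | z ∈ closedBall (0 : ℂ) 1 ∧ ‖X z - p‖ ≤ R} :=
    ((((hX.continuousOn_fderiv_apply 1).norm.pow 2).mul
      (hhf.add (hf.mul hhf'))).mono hKU).integrableOn_compact hK
  refine ⟨hint, ?_⟩
  have hsum := integral_add (hvar 1) (hvar Complex.I)
  rw [e1, e2] at hsum
  have hle : ∫ z in {z | z ∈ closedBall (0 : ℂ) 1 ∧ ‖X z - p‖ ≤ R}, 2 * (‖partialX X z‖ ^ 2 *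
        (h (‖X z - p‖ ^ 2) + ‖X z - p‖ ^ 2 * h' (‖X z - p‖ ^ 2))) ≤ 0 + 0 := by
    rw [← hsum]
    refine setIntegral_mono_on (hint.const_mul 2) ((hvar 1).add (hvar Complex.I))
      hK.measurableSet fun z hz => ?_
    have hzb := hKU hz
    have c1 := hX.inner_eq_zero z hzb
    have c2 := hX.norm_eq z hzb
    have c3 := inner_sq_add_inner_sq_le (w := X z - p) c1 c2
    have c4 := mul_le_mul_of_nonpos_left c3 (hneg (‖X z - p‖ ^ 2) (sq_nonneg _))
    have c5 : inner ℝ (X z - p) (fderiv ℝ (fderiv ℝ X) z 1 1) +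
        inner ℝ (X z - p) (fderiv ℝ (fderiv ℝ X) z Complex.I Complex.I) = 0 := by
      rw [← inner_add_right, hX.fderiv_fderiv_add hzb, inner_zero_right]
    have c6 : inner ℝ (X z - p) (fderiv ℝ (fderiv ℝ X) z Complex.I Complex.I) =
        - inner ℝ (X z - p) (fderiv ℝ (fderiv ℝ X) z 1 1) := by linarith
    change _ ≤ _ + _
    rw [c6]
    simp only [partialX, partialY] at *
    rw [← c2]
    nlinarith
  rw [integral_const_mul] at hle
  linarith

end IsConformalHarmonicDisc

/-! ### Monotonicity: lower area bounds -/

namespace IsConformalHarmonicDisc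

variable {X : ℂ → Space3}

theorem norm_fderiv_apply_le (hX : IsConformalHarmonicDisc X) {z : ℂ} (hz : z ∈ ball (0 : ℂ) 1)
    (v : ℂ) : ‖fderiv ℝ X z v‖ ≤ 2 * ‖partialX X z‖ * ‖v‖ := by
  have h1 : v = v.re • (1 : ℂ) + v.im • Complex.I := by simp
  have h2 : fderiv ℝ X z v = v.re • partialX X z + v.im • partialY X z := by
    conv_lhs => rw [h1]
    rw [map_add, map_smul, map_smul]
    rfl
  rw [h2]
  calc _ ≤ ‖v.re • partialX X z‖ + ‖v.im • partialY X z‖ := norm_add_le _ _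
    _ = |v.re| * ‖partialX X z‖ + |v.im| * ‖partialX X z‖ := by
      rw [norm_smul, norm_smul, hX.norm_eq z hz]; rfl
    _ ≤ ‖v‖ * ‖partialX X z‖ + ‖v‖ * ‖partialX X z‖ := by
      gcongr
      · exact Complex.abs_re_le_norm v
      · exact Complex.abs_im_le_norm v
    _ = _ := by ring

theorem fderiv_eq_zero (hX : IsConformalHarmonicDisc X) {z : ℂ} (hz : z ∈ ball (0 : ℂ) 1)
    (h : partialX X z = 0) : fderiv ℝ X z = 0 := by
  ext1 v
  have := hX.norm_fderiv_apply_le hz v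
  rw [h, norm_zero, mul_zero, zero_mul] at this
  simpa using this

/-- Monotonicity: a conformal harmonic disc through `p = X z₁`, immersed at `z₁`, has area at least
a universal multiple of `R²` in a ball of radius `R` about `p` that avoids its boundary. -/
theorem le_setIntegral_of_partialX_ne_zero (hX : IsConformalHarmonicDisc X) {R : ℝ} (hR : 0 < R)
    {z₁ : ℂ} (hz₁ : z₁ ∈ ball (0 : ℂ) 1) (hne : partialX X z₁ ≠ 0)
    (hb : ∀ w ∈ sphere (0 : ℂ) 1, R < ‖X w - X z₁‖) :
    R ^ 2 / 200 ≤
      ∫ z in {z | z ∈ closedBall (0 : ℂ) 1 ∧ ‖X z - X z₁‖ ≤ R}, ‖partialX X z‖ ^ 2 := by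
  obtain ⟨hK, hKU⟩ := hX.isCompact_preimage hb
  set p := X z₁ with hp
  set K := {z | z ∈ closedBall (0 : ℂ) 1 ∧ ‖X z - p‖ ≤ R} with hKdef
  set c := ‖partialX X z₁‖ with hc
  have hc0 : 0 < c := norm_pos_iff.2 hne
  have hnb : ball (0 : ℂ) 1 ∈ 𝓝 z₁ := isOpen_ball.mem_nhds hz₁
  have hcont : ContinuousOn (fun z => ‖partialX X z‖ ^ 2) (ball 0 1) :=
    (hX.continuousOn_fderiv_apply 1).norm.pow 2
  have hd : HasFDerivAt X (fderiv ℝ X z₁) z₁ :=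
    ((hX.contDiffAt hz₁).differentiableAt (by norm_num)).hasFDerivAt
  -- The factor `3c` is `2c` from the differential plus `c` from the remainder. Hence `ρ = (3cδ)²`
  -- below bounds `|X - p|²` on the `δ`-disc about `z₁`.
  have hE : ∀ᶠ z in 𝓝 z₁, z ∈ ball (0 : ℂ) 1 ∧ ‖X z - p‖ ≤ 3 * c * ‖z - z₁‖ ∧
      c ^ 2 / 2 ≤ ‖partialX X z‖ ^ 2 := by
    filter_upwards [hnb, hd.isLittleO.bound hc0, (hcont.continuousAt hnb).eventually_const_lt
      (show c ^ 2 / 2 < ‖partialX X z₁‖ ^ 2 by rw [← hc]; nlinarith)] with z h1 h2 h3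
    refine ⟨h1, ?_, h3.le⟩
    have h4 := hX.norm_fderiv_apply_le hz₁ (z - z₁)
    have h5 : X z - p = (X z - X z₁ - fderiv ℝ X z₁ (z - z₁)) + fderiv ℝ X z₁ (z - z₁) := by
      rw [hp]; abel
    rw [h5]
    refine (norm_add_le _ _).trans ?_
    linarith
  obtain ⟨δ₀, hδ₀, hball⟩ := Metric.eventually_nhds_iff_ball.1 hE
  set δ := min (δ₀ / 2) (R / (6 * c)) with hδdef
  have hδ : 0 < δ := by positivity
  have hδ1 : δ < δ₀ := (min_le_left _ _).trans_lt (by linarith)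
  have hδ2 : δ * (6 * c) ≤ R := (le_div_iff₀ (by positivity)).1 (min_le_right _ _)
  have hρR : 9 * c ^ 2 * δ ^ 2 ≤ R ^ 2 / 2 := by
    have h36 := pow_le_pow_left₀ (by positivity) hδ2 2
    nlinarith [sq_nonneg (c * δ)]
  have hρ : 0 < 9 * c ^ 2 * δ ^ 2 := by positivity
  set ρ := 9 * c ^ 2 * δ ^ 2 with hρdef
  have hW : ∀ z ∈ closedBall z₁ δ, z ∈ K ∧ ‖X z - p‖ ^ 2 ≤ ρ ∧ c ^ 2 / 2 ≤ ‖partialX X z‖ ^ 2 := by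
    intro z hz
    obtain ⟨h1, h2, h3⟩ := hball z (closedBall_subset_ball hδ1 hz)
    have h4 : ‖X z - p‖ ≤ 3 * c * δ :=
      h2.trans (mul_le_mul_of_nonneg_left (mem_closedBall_iff_norm.1 hz) (by positivity))
    refine ⟨⟨ball_subset_closedBall h1, ?_⟩, ?_, h3⟩
    · nlinarith [mul_pos hc0 hδ]
    · have := pow_le_pow_left₀ (norm_nonneg _) h4 2
      rw [hρdef]; linarith
  have hWK : closedBall z₁ δ ⊆ K := fun z hz => (hW z hz).1
  obtain ⟨h, h', hh, hh', h0, hneg, hl1, hl2⟩ := exists_radial_cutoff hR hρ hρR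
  obtain ⟨hint, hle⟩ := hX.setIntegral_radial_nonpos hR hb hh hh' h0 hneg
  have hlam : IntegrableOn (fun z => ‖partialX X z‖ ^ 2) K :=
    (hcont.mono hKU).integrableOn_compact hK
  have hlamW : IntegrableOn (fun z => ‖partialX X z‖ ^ 2) (closedBall z₁ δ) := hlam.mono_set hWK
  have hind : IntegrableOn ((closedBall z₁ δ).indicator (fun z => ‖partialX X z‖ ^ 2)) K :=
    (hlamW.integrable_indicator measurableSet_closedBall).integrableOn
  have hmain : ∫ z in K, (1 / (16 * ρ) *
      (closedBall z₁ δ).indicator (fun z => ‖partialX X z‖ ^ 2) z -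
      2 / R ^ 2 * ‖partialX X z‖ ^ 2) ≤ 0 := by
    refine le_trans (setIntegral_mono_on ((hind.const_mul _).sub (hlam.const_mul _)) hint
      hK.measurableSet fun z hz => ?_) hle
    have hlamz : 0 ≤ ‖partialX X z‖ ^ 2 := sq_nonneg _
    by_cases hzW : z ∈ closedBall z₁ δ
    · rw [indicator_of_mem hzW]
      have := mul_le_mul_of_nonneg_left (hl2 (‖X z - p‖ ^ 2) (sq_nonneg _) (hW z hzW).2.1) hlamz
      linarith
    · rw [indicator_of_notMem hzW]
      have := mul_le_mul_of_nonneg_left (hl1 (‖X z - p‖ ^ 2) (sq_nonneg _)) hlamz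
      linarith
  rw [integral_sub (hind.const_mul _) (hlam.const_mul _), integral_const_mul, integral_const_mul,
    setIntegral_indicator measurableSet_closedBall, inter_eq_self_of_subset_right hWK] at hmain
  have hvol : volume.real (closedBall z₁ δ) = Real.pi * δ ^ 2 := by
    rw [measureReal_def, Complex.volume_closedBall]
    simp [hδ.le]
    ring
  have hlow : c ^ 2 / 2 * (Real.pi * δ ^ 2) ≤ ∫ z in closedBall z₁ δ, ‖partialX X z‖ ^ 2 := by
    have := setIntegral_mono_on (μ := volume) (s := closedBall z₁ δ) (f := fun _ => c ^ 2 / 2)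
      (integrableOn_const (by simp [Complex.volume_closedBall, ENNReal.mul_eq_top])) hlamW
      measurableSet_closedBall (fun z hz => (hW z hz).2.2)
    rw [setIntegral_const, hvol, smul_eq_mul] at this
    linarith
  -- Both `ρ` and the lower bound for the integral scale like `c²δ²`, so the quotient is universal
  -- and no limit `δ → 0` is needed.
  have hlow2 : 3 / 288 ≤ 1 / (16 * ρ) * ∫ z in closedBall z₁ δ, ‖partialX X z‖ ^ 2 := by
    refine le_trans ?_ (mul_le_mul_of_nonneg_left hlow (by positivity))
    have : 1 / (16 * ρ) * (c ^ 2 / 2 * (Real.pi * δ ^ 2)) = Real.pi / 288 := by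
      rw [hρdef]; field_simp; norm_num
    rw [this]
    linarith [Real.pi_gt_three]
  have h6 : 3 / 288 ≤ 2 / R ^ 2 * ∫ z in K, ‖partialX X z‖ ^ 2 := by linarith
  rw [div_mul_eq_mul_div, le_div_iff₀ (by positivity)] at h6
  nlinarith [sq_nonneg R]

/-- The points where the differential does not vanish are dense. -/
theorem exists_partialX_ne_zero_near (hX : IsConformalHarmonicDisc X) {R : ℝ} (hR : 0 < R)
    {z₁ : ℂ} (hz₁ : z₁ ∈ ball (0 : ℂ) 1) (hb : ∀ w ∈ sphere (0 : ℂ) 1, R ≤ ‖X w - X z₁‖)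
    {η : ℝ} (hη : 0 < η) :
    ∃ z ∈ ball (0 : ℂ) 1, ‖X z - X z₁‖ < η ∧ partialX X z ≠ 0 := by
  by_contra! hcon
  have hnb : ball (0 : ℂ) 1 ∈ 𝓝 z₁ := isOpen_ball.mem_nhds hz₁
  have hc : ∀ᶠ z in 𝓝 z₁, ‖X z - X z₁‖ < η :=
    (((hX.continuousOn_norm_sub (X z₁)).mono ball_subset_closedBall).continuousAt
      hnb).eventually_lt_const (by simpa using hη)
  obtain ⟨r, hr, hball⟩ := Metric.eventually_nhds_iff_ball.1 (hc.and hnb)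
  have hconst : ∀ w ∈ ball z₁ r, X w = X z₁ := by
    intro w hw
    have hbound : ∀ y ∈ ball z₁ r, ‖fderivWithin ℝ X (ball z₁ r) y‖ ≤ 0 := by
      intro y hy
      rw [fderivWithin_of_isOpen isOpen_ball hy]
      obtain ⟨h1, h2⟩ := hball y hy
      rw [hX.fderiv_eq_zero h2 (hcon y h2 h1), norm_zero]
    have hdiff : DifferentiableOn ℝ X (ball z₁ r) := fun y hy =>
      ((hX.contDiffAt (hball y hy).2).differentiableAt (by norm_num)).differentiableWithinAt
    have := (convex_ball z₁ r).norm_image_sub_le_of_norm_fderivWithin_le hdiff hbound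
      (mem_ball_self hr) hw
    rw [zero_mul] at this
    exact sub_eq_zero.1 (norm_le_zero_iff.1 this)
  have h1 := hX.eqOn_const hz₁ (Filter.eventually_of_mem (ball_mem_nhds z₁ hr) hconst) 1 (by simp)
  have h2 := hb 1 (by simp)
  rw [h1, sub_self, norm_zero] at h2
  linarith

/-- The area of a conformal harmonic disc in a ball of radius `R` about one of its points, where the
ball avoids the boundary of the disc, is at least a universal multiple of `R²`. -/
theorem le_lintegral_preimage_ball (hX : IsConformalHarmonicDisc X) {R : ℝ} (hR : 0 < R)
    {z₁ : ℂ} (hz₁ : z₁ ∈ ball (0 : ℂ) 1) (hb : ∀ w ∈ sphere (0 : ℂ) 1, R ≤ ‖X w - X z₁‖) :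
    ENNReal.ofReal (R ^ 2 / 3200) ≤
      ∫⁻ z in ball (0 : ℂ) 1 ∩ {z | ‖X z - X z₁‖ < R}, ENNReal.ofReal (‖partialX X z‖ ^ 2) := by
  -- `z₁` may be a branch point: move to an immersed point less than `R/4` away and use radius `R/4`
  -- there, whence `3200 = 16 · 200`.
  obtain ⟨z, hz, hzη, hne⟩ := hX.exists_partialX_ne_zero_near hR hz₁ hb (show 0 < R / 4 by linarith)
  have hb' : ∀ w ∈ sphere (0 : ℂ) 1, R / 4 < ‖X w - X z‖ := by
    intro w hw
    have h1 := hb w hw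
    have h2 := norm_sub_le_norm_sub_add_norm_sub (X w) (X z) (X z₁)
    linarith
  obtain ⟨hK, hKU⟩ := hX.isCompact_preimage hb'
  have hmain := hX.le_setIntegral_of_partialX_ne_zero (show 0 < R / 4 by linarith) hz hne hb'
  have hint : IntegrableOn (fun z => ‖partialX X z‖ ^ 2)
      {y | y ∈ closedBall (0 : ℂ) 1 ∧ ‖X y - X z‖ ≤ R / 4} :=
    (((hX.continuousOn_fderiv_apply 1).norm.pow 2).mono hKU).integrableOn_compact hK
  calc ENNReal.ofReal (R ^ 2 / 3200) = ENNReal.ofReal ((R / 4) ^ 2 / 200) := by congr 1; ring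
    _ ≤ ENNReal.ofReal (∫ y in {y | y ∈ closedBall (0 : ℂ) 1 ∧ ‖X y - X z‖ ≤ R / 4},
          ‖partialX X y‖ ^ 2) := ENNReal.ofReal_le_ofReal hmain
    _ = ∫⁻ y in {y | y ∈ closedBall (0 : ℂ) 1 ∧ ‖X y - X z‖ ≤ R / 4},
          ENNReal.ofReal (‖partialX X y‖ ^ 2) :=
      ofReal_integral_eq_lintegral_ofReal hint (Eventually.of_forall fun _ => sq_nonneg _)
    _ ≤ _ := by
      refine lintegral_mono_set fun y hy => ⟨hKU hy, ?_⟩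
      have h2 := norm_sub_le_norm_sub_add_norm_sub (X y) (X z) (X z₁)
      have h3 : ‖X y - X z‖ ≤ R / 4 := hy.2
      change ‖X y - X z₁‖ < R
      linarith

/-- Conformality turns energy into area. -/
theorem dirichletEnergy_eq (hX : IsConformalHarmonicDisc X) :
    dirichletEnergy X = ∫⁻ z in ball (0 : ℂ) 1, ENNReal.ofReal (‖partialX X z‖ ^ 2) := by
  rw [dirichletEnergy, ← lintegral_const_mul' _ _ (by simp)]
  refine setLIntegral_congr_fun measurableSet_ball fun z hz => ?_
  rw [← hX.norm_eq z hz, ← two_mul, ENNReal.ofReal_mul (by norm_num), ← mul_assoc,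
    ENNReal.ofReal_ofNat, ENNReal.inv_mul_cancel (by norm_num) (by norm_num), one_mul]

/-- Finitely many disjoint balls about points of the disc, away from its boundary, bound the energy
from below. -/
theorem card_mul_le_dirichletEnergy (hX : IsConformalHarmonicDisc X) {R : ℝ} (hR : 0 < R)
    {N : ℕ} {ζ : ℕ → ℂ} (hζ : ∀ k < N, ζ k ∈ ball (0 : ℂ) 1)
    (hb : ∀ k < N, ∀ w ∈ sphere (0 : ℂ) 1, R ≤ ‖X w - X (ζ k)‖)
    (hdisj : ∀ j < N, ∀ k < N, j ≠ k → 2 * R ≤ ‖X (ζ j) - X (ζ k)‖) :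
    ENNReal.ofReal (N * (R ^ 2 / 3200)) ≤ dirichletEnergy X := by
  set B : ℕ → Set ℂ := fun k => ball (0 : ℂ) 1 ∩ {z | ‖X z - X (ζ k)‖ < R} with hB
  have hmeas : ∀ k, MeasurableSet (B k) := fun k =>
    (((hX.continuousOn_norm_sub _).mono ball_subset_closedBall).isOpen_inter_preimage
      isOpen_ball isOpen_Iio).measurableSet
  have hpd : Set.PairwiseDisjoint (↑(Finset.range N)) B := by
    intro j hj k hk hjk
    rw [Function.onFun, Set.disjoint_left]
    rintro z ⟨-, hz1⟩ ⟨-, hz2⟩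
    have h1 := hdisj j (Finset.mem_range.1 hj) k (Finset.mem_range.1 hk) hjk
    have h2 := norm_sub_le_norm_sub_add_norm_sub (X (ζ j)) (X z) (X (ζ k))
    rw [norm_sub_rev (X (ζ j)) (X z)] at h2
    have h3 : ‖X z - X (ζ j)‖ < R := hz1
    have h4 : ‖X z - X (ζ k)‖ < R := hz2
    linarith
  calc ENNReal.ofReal (N * (R ^ 2 / 3200))
      = ∑ _k ∈ Finset.range N, ENNReal.ofReal (R ^ 2 / 3200) := by
        rw [ENNReal.ofReal_mul (by positivity)]; simp
    _ ≤ ∑ k ∈ Finset.range N, ∫⁻ z in B k, ENNReal.ofReal (‖partialX X z‖ ^ 2) :=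
        Finset.sum_le_sum fun k hk => by
          have hk := Finset.mem_range.1 hk
          exact hX.le_lintegral_preimage_ball hR (hζ k hk) (hb k hk)
    _ = ∫⁻ z in ⋃ k ∈ Finset.range N, B k, ENNReal.ofReal (‖partialX X z‖ ^ 2) :=
        (lintegral_biUnion_finset hpd (fun k _ => hmeas k) _).symm
    _ ≤ dirichletEnergy X := by
        rw [hX.dirichletEnergy_eq]
        exact lintegral_mono_set (iUnion₂_subset fun k _ => inter_subset_left)

end IsConformalHarmonicDisc

/-! ### Geometry of the curve -/

namespace IsArclengthEmbeddedC2

variable {ℓ : ℝ} {Γ : ℝ → Space3}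

theorem hasDerivWithinAt (hΓ : IsArclengthEmbeddedC2 ℓ Γ) {s : ℝ} (hs : s ∈ Icc 0 ℓ) :
    HasDerivWithinAt Γ (derivWithin Γ (Icc 0 ℓ) s) (Icc 0 ℓ) s :=
  ((hΓ.contDiffOn.differentiableOn (by norm_num)) s hs).hasDerivWithinAt

theorem norm_sub_le (hΓ : IsArclengthEmbeddedC2 ℓ Γ) {s t : ℝ} (hs : s ∈ Icc 0 ℓ)
    (ht : t ∈ Icc 0 ℓ) : ‖Γ s - Γ t‖ ≤ |s - t| := by
  have h := (convex_Icc 0 ℓ).norm_image_sub_le_of_norm_hasDerivWithin_le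
    (fun x hx => hΓ.hasDerivWithinAt hx) (fun x hx => (hΓ.unit_speed x hx).le) ht hs
  rwa [one_mul, Real.norm_eq_abs] at h

/-- The unit tangent is Lipschitz. -/
theorem exists_lipschitz_tangent (hΓ : IsArclengthEmbeddedC2 ℓ Γ) :
    ∃ M : ℝ, 0 < M ∧ ∀ s ∈ Icc 0 ℓ, ∀ t ∈ Icc 0 ℓ,
      ‖derivWithin Γ (Icc 0 ℓ) s - derivWithin Γ (Icc 0 ℓ) t‖ ≤ M * |s - t| := by
  have hu : UniqueDiffOn ℝ (Icc 0 ℓ) := uniqueDiffOn_Icc hΓ.length_pos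
  have h1 : ContDiffOn ℝ 1 (derivWithin Γ (Icc 0 ℓ)) (Icc 0 ℓ) :=
    hΓ.contDiffOn.derivWithin hu (by norm_num)
  obtain ⟨C, hC⟩ := isCompact_Icc.exists_bound_of_continuousOn
    (h1.continuousOn_derivWithin hu le_rfl)
  refine ⟨max C 1, lt_max_of_lt_right one_pos, fun s hs t ht => ?_⟩
  have h := (convex_Icc 0 ℓ).norm_image_sub_le_of_norm_derivWithin_le
    (h1.differentiableOn (by norm_num)) (fun x hx => (hC x hx).trans (le_max_left C 1)) ht hs
  rwa [Real.norm_eq_abs] at h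

/-- Mean value inequality for `x ↦ Γ x - x T(t)`, where `T` is the unit tangent. -/
theorem norm_sub_sub_smul_le (hΓ : IsArclengthEmbeddedC2 ℓ Γ) {M : ℝ} (hM : 0 < M)
    (hLip : ∀ s ∈ Icc 0 ℓ, ∀ t ∈ Icc 0 ℓ,
      ‖derivWithin Γ (Icc 0 ℓ) s - derivWithin Γ (Icc 0 ℓ) t‖ ≤ M * |s - t|)
    {s t : ℝ} (hs : s ∈ Icc 0 ℓ) (ht : t ∈ Icc 0 ℓ) :
    ‖Γ s - Γ t - (s - t) • derivWithin Γ (Icc 0 ℓ) t‖ ≤ M * |s - t| ^ 2 := by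
  have hsub : uIcc t s ⊆ Icc 0 ℓ := uIcc_subset_Icc ht hs
  have hd : ∀ x ∈ uIcc t s, HasDerivWithinAt (fun x => Γ x - x • derivWithin Γ (Icc 0 ℓ) t)
      (derivWithin Γ (Icc 0 ℓ) x - (1 : ℝ) • derivWithin Γ (Icc 0 ℓ) t) (uIcc t s) x := fun x hx =>
    ((hΓ.hasDerivWithinAt (hsub hx)).mono hsub).sub
      ((hasDerivWithinAt_id x _).smul_const _)
  have hb : ∀ x ∈ uIcc t s,
      ‖derivWithin Γ (Icc 0 ℓ) x - (1 : ℝ) • derivWithin Γ (Icc 0 ℓ) t‖ ≤ M * |s - t| := by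
    intro x hx
    rw [one_smul]
    refine (hLip x (hsub hx) t ht).trans (mul_le_mul_of_nonneg_left ?_ hM.le)
    exact abs_sub_left_of_mem_uIcc hx
  have h := (convex_uIcc t s).norm_image_sub_le_of_norm_hasDerivWithin_le hd hb
    left_mem_uIcc right_mem_uIcc
  have e : Γ s - s • derivWithin Γ (Icc 0 ℓ) t - (Γ t - t • derivWithin Γ (Icc 0 ℓ) t) =
      Γ s - Γ t - (s - t) • derivWithin Γ (Icc 0 ℓ) t := by module
  rw [e, Real.norm_eq_abs] at h
  linarith

/-- Near the diagonal the tangent approximation gives the constant `2`; away from it injectivity and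
compactness bound the chord from below. -/
theorem exists_chord_arc (hΓ : IsArclengthEmbeddedC2 ℓ Γ) :
    ∃ c : ℝ, 0 < c ∧ ∀ s ∈ Icc 0 ℓ, ∀ t ∈ Icc 0 ℓ, |s - t| ≤ c * ‖Γ s - Γ t‖ := by
  obtain ⟨M, hM, hLip⟩ := hΓ.exists_lipschitz_tangent
  have hΓc : ContinuousOn Γ (Icc 0 ℓ) := hΓ.contDiffOn.continuousOn
  have hK : IsCompact ((Icc 0 ℓ ×ˢ Icc 0 ℓ) ∩ {p : ℝ × ℝ | 1 / (2 * M) ≤ |p.1 - p.2|}) :=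
    (isCompact_Icc.prod isCompact_Icc).inter_right
      (isClosed_le continuous_const (by fun_prop))
  have hc : ContinuousOn (fun p : ℝ × ℝ => ‖Γ p.1 - Γ p.2‖)
      ((Icc 0 ℓ ×ˢ Icc 0 ℓ) ∩ {p : ℝ × ℝ | 1 / (2 * M) ≤ |p.1 - p.2|}) :=
    ((hΓc.comp continuousOn_fst fun p hp => hp.1.1).sub
      (hΓc.comp continuousOn_snd fun p hp => hp.1.2)).norm
  obtain ⟨m, hm, hmle⟩ : ∃ m : ℝ, 0 < m ∧ ∀ s ∈ Icc 0 ℓ, ∀ t ∈ Icc 0 ℓ, 1 / (2 * M) ≤ |s - t| →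
      m ≤ ‖Γ s - Γ t‖ := by
    obtain ⟨m, hm, h⟩ := hK.exists_forall_le' (a := 0) hc (by
      rintro p ⟨⟨h1, h2⟩, h3⟩
      refine norm_pos_iff.2 (sub_ne_zero.2 fun h => ?_)
      have h4 := hΓ.injOn h1 h2 h
      have h5 : 1 / (2 * M) ≤ |p.1 - p.2| := h3
      rw [h4, sub_self, abs_zero] at h5
      exact absurd h5 (not_le.2 (by positivity)))
    exact ⟨m, hm, fun s hs t ht hst => h (s, t) ⟨⟨hs, ht⟩, hst⟩⟩
  have hℓ := hΓ.length_pos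
  refine ⟨max 2 (ℓ / m), lt_max_of_lt_left two_pos, fun s hs t ht => ?_⟩
  rcases le_total (1 / (2 * M)) |s - t| with h | h
  · have h1 := hmle s hs t ht h
    have h2 : |s - t| ≤ ℓ := abs_sub_le_of_nonneg_of_le hs.1 hs.2 ht.1 ht.2
    calc |s - t| ≤ ℓ / m * m := by rw [div_mul_cancel₀ _ hm.ne']; exact h2
      _ ≤ max 2 (ℓ / m) * ‖Γ s - Γ t‖ :=
        mul_le_mul (le_max_right _ _) h1 hm.le (by positivity)
  · have h1 := hΓ.norm_sub_sub_smul_le hM hLip hs ht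
    have h2 : ‖(s - t) • derivWithin Γ (Icc 0 ℓ) t‖ = |s - t| := by
      rw [norm_smul, hΓ.unit_speed t ht, mul_one, Real.norm_eq_abs]
    have h3 := norm_sub_norm_le ((s - t) • derivWithin Γ (Icc 0 ℓ) t) (Γ s - Γ t)
    rw [norm_sub_rev _ (Γ s - Γ t), h2] at h3
    have h4 : |s - t| * (2 * M) ≤ 1 := (le_div_iff₀ (by positivity)).1 h
    have h5 : |s - t| ≤ 2 * ‖Γ s - Γ t‖ := by nlinarith [abs_nonneg (s - t)]
    exact h5.trans (mul_le_mul_of_nonneg_right (le_max_left _ _) (norm_nonneg _))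

/-- The first order condition at a point of the curve nearest to `x`. -/
theorem inner_tangent_mul_nonpos (hΓ : IsArclengthEmbeddedC2 ℓ Γ) {x : Space3} {s : ℝ}
    (hs : s ∈ Icc 0 ℓ) (hmin : ∀ t ∈ Icc 0 ℓ, ‖x - Γ s‖ ≤ ‖x - Γ t‖) {t : ℝ} (ht : t ∈ Icc 0 ℓ) :
    (t - s) * inner ℝ (x - Γ s) (derivWithin Γ (Icc 0 ℓ) s) ≤ 0 := by
  obtain ⟨M, hM, hLip⟩ := hΓ.exists_lipschitz_tangent
  set A := (t - s) * inner ℝ (x - Γ s) (derivWithin Γ (Icc 0 ℓ) s) with hA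
  set C := (1 + 2 * ‖x - Γ s‖ * M) * |t - s| ^ 2 with hC
  have hC0 : 0 ≤ C := by positivity
  -- Compare `s` with `s + θ(t - s)`, `θ` small. As `s` may be an end point, only an inequality
  -- results.
  have key : ∀ θ : ℝ, 0 < θ → θ ≤ 1 → 2 * A ≤ θ * C := by
    intro θ h0 h1
    have hy : s + θ * (t - s) ∈ Icc 0 ℓ := by
      have := (convex_Icc 0 ℓ).add_smul_sub_mem hs ht ⟨h0.le, h1⟩
      simpa using this
    set y := s + θ * (t - s) with hydef
    have hys : y - s = θ * (t - s) := by rw [hydef]; ring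
    have e1 := hΓ.norm_sub_sub_smul_le hM hLip hy hs
    have e2 := hΓ.norm_sub_le hy hs
    have e3 := hmin y hy
    rw [hys, abs_mul, abs_of_pos h0] at e1 e2
    have e4 : x - Γ y = (x - Γ s) - (Γ y - Γ s) := by abel
    have e5 : 2 * inner ℝ (x - Γ s) (Γ y - Γ s) ≤ (θ * |t - s|) ^ 2 := by
      have h6 := pow_le_pow_left₀ (norm_nonneg _) e3 2
      have h7 := pow_le_pow_left₀ (norm_nonneg _) e2 2
      rw [e4, norm_sub_sq_real (x - Γ s)] at h6
      linarith
    have e6 : inner ℝ (x - Γ s) (Γ y - Γ s) = θ * A + inner ℝ (x - Γ s)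
        (Γ y - Γ s - (θ * (t - s)) • derivWithin Γ (Icc 0 ℓ) s) := by
      rw [inner_sub_right _ (Γ y - Γ s), inner_smul_right, hA]; ring
    have e7 := (abs_le.1 ((abs_real_inner_le_norm (x - Γ s)
      (Γ y - Γ s - (θ * (t - s)) • derivWithin Γ (Icc 0 ℓ) s)).trans
      (mul_le_mul_of_nonneg_left e1 (norm_nonneg _)))).1
    have e8 : θ * (2 * A) ≤ θ * (θ * C) := by rw [hC]; linarith
    exact le_of_mul_le_mul_left e8 h0
  by_contra! hpos
  have h1 := key (min 1 (A / (C + 1))) (by positivity) (min_le_left _ _)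
  have h2 : min 1 (A / (C + 1)) * C ≤ A / (C + 1) * C :=
    mul_le_mul_of_nonneg_right (min_le_right _ _) hC0
  have h3 : A / (C + 1) * C ≤ A := by
    rw [div_mul_eq_mul_div, div_le_iff₀ (by positivity)]
    nlinarith
  linarith

/-- The curve bends away from its normal discs at most quadratically. -/
theorem exists_inner_le_sq (hΓ : IsArclengthEmbeddedC2 ℓ Γ) :
    ∃ K : ℝ, 0 < K ∧ ∀ x : Space3, ∀ s ∈ Icc 0 ℓ, (∀ t ∈ Icc 0 ℓ, ‖x - Γ s‖ ≤ ‖x - Γ t‖) →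
      ∀ t ∈ Icc 0 ℓ, inner ℝ (x - Γ s) (Γ t - Γ s) ≤ ‖x - Γ s‖ * (K * ‖Γ t - Γ s‖ ^ 2) := by
  obtain ⟨M, hM, hLip⟩ := hΓ.exists_lipschitz_tangent
  obtain ⟨c, hc, hca⟩ := hΓ.exists_chord_arc
  refine ⟨M * c ^ 2, by positivity, fun x s hs hmin t ht => ?_⟩
  have h1 := hΓ.inner_tangent_mul_nonpos hs hmin ht
  have h2 := hΓ.norm_sub_sub_smul_le hM hLip ht hs
  have h3 := pow_le_pow_left₀ (abs_nonneg _) (hca t ht s hs) 2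
  -- The tangential part has a good sign at a nearest point; the remainder is quadratic in the chord
  -- by the chord-arc bound.
  have h4 : inner ℝ (x - Γ s) (Γ t - Γ s) =
      (t - s) * inner ℝ (x - Γ s) (derivWithin Γ (Icc 0 ℓ) s) + inner ℝ (x - Γ s)
        (Γ t - Γ s - (t - s) • derivWithin Γ (Icc 0 ℓ) s) := by
    rw [inner_sub_right _ (Γ t - Γ s), inner_smul_right]; ring
  have h5 := real_inner_le_norm (x - Γ s) (Γ t - Γ s - (t - s) • derivWithin Γ (Icc 0 ℓ) s)
  have h6 : ‖Γ t - Γ s - (t - s) • derivWithin Γ (Icc 0 ℓ) s‖ ≤ M * c ^ 2 * ‖Γ t - Γ s‖ ^ 2 := by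
    refine h2.trans ?_
    rw [mul_assoc, ← mul_pow]
    exact mul_le_mul_of_nonneg_left h3 hM.le
  have h7 := mul_le_mul_of_nonneg_left h6 (norm_nonneg (x - Γ s))
  linarith

theorem exists_nearest (hΓ : IsArclengthEmbeddedC2 ℓ Γ) (x : Space3) :
    ∃ s ∈ Icc 0 ℓ, (∀ t ∈ Icc 0 ℓ, ‖x - Γ s‖ ≤ ‖x - Γ t‖) ∧
      infDist x (Γ '' Icc 0 ℓ) = ‖x - Γ s‖ := by
  have hne : (Icc 0 ℓ).Nonempty := nonempty_Icc.2 hΓ.length_pos.le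
  obtain ⟨y, ⟨s, hs, rfl⟩, h⟩ := (isCompact_Icc.image_of_continuousOn
    hΓ.contDiffOn.continuousOn).exists_infDist_eq_dist (hne.image Γ) x
  refine ⟨s, hs, fun t ht => ?_, by rw [h, dist_eq_norm]⟩
  rw [← dist_eq_norm, ← dist_eq_norm, ← h]
  exact infDist_le_dist_of_mem (mem_image_of_mem Γ ht)

theorem mem_metricTube_iff (hΓ : IsArclengthEmbeddedC2 ℓ Γ) {r : ℝ} (hr : 0 ≤ r) {x : Space3} :
    x ∈ metricTube ℓ Γ r ↔ ∃ s ∈ Icc 0 ℓ, ‖x - Γ s‖ ≤ r := by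
  rw [metricTube, (isCompact_Icc.image_of_continuousOn
    hΓ.contDiffOn.continuousOn).cthickening_eq_biUnion_closedBall hr]
  simp [dist_eq_norm]

end IsArclengthEmbeddedC2

/-! ### The distance estimate -/

namespace IsConformalHarmonicDisc

variable {ℓ : ℝ} {Γ : ℝ → Space3} {X : ℂ → Space3}

theorem norm_sub_le_of_sphere (hX : IsConformalHarmonicDisc X) {q : Space3} {D : ℝ}
    (hb : ∀ w ∈ sphere (0 : ℂ) 1, ‖X w - q‖ ≤ D) {z : ℂ} (hz : z ∈ closedBall (0 : ℂ) 1) :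
    ‖X z - q‖ ≤ D := by
  -- With `g = 0` the level `1` is never reached: this is the ordinary maximum principle.
  obtain ⟨w, -, h1, -, h2⟩ := exists_ge_of_harmonic (g := fun _ => 0) (t := 1)
    (hX.continuousOn_inner q (X z - q)) continuousOn_const (hX.harmonicOnNhd_inner q (X z - q)) hz
    zero_le_one
  have hw := hb w (h2.resolve_left (by norm_num))
  simp only [real_inner_self_eq_norm_sq] at h1
  have h3 := real_inner_le_norm (X z - q) (X w - q)
  by_contra! hlt
  have h4 : 0 < ‖X z - q‖ := ((norm_nonneg _).trans hw).trans_lt hlt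
  nlinarith

/-- A point of the disc at distance `d` from the curve, far from the boundary values, forces area
of order `d ^ (3 / 2)`. -/
theorem dist_pow_three_le (hX : IsConformalHarmonicDisc X) {K : ℝ} (hK : 0 < K)
    {r₁ α : ℝ} (hα : 0 < α)
    (hb : ∀ w ∈ sphere (0 : ℂ) 1, ∃ t ∈ Icc 0 ℓ, ‖X w - Γ t‖ ≤ r₁)
    (hE : dirichletEnergy X ≤ ENNReal.ofReal α) {z₀ : ℂ} (hz₀ : z₀ ∈ closedBall (0 : ℂ) 1)
    {q : Space3} (hd : 0 < ‖X z₀ - q‖) (hr : 8 * r₁ ≤ ‖X z₀ - q‖)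
    (hd₀ : ‖X z₀ - q‖ ≤ 1 / (72 * K))
    (hq : ∀ t ∈ Icc 0 ℓ, inner ℝ (X z₀ - q) (Γ t - q) ≤ ‖X z₀ - q‖ * (K * ‖Γ t - q‖ ^ 2)) :
    ‖X z₀ - q‖ ^ 3 ≤ 72 * K * (51200 * α) ^ 2 := by
  set d := ‖X z₀ - q‖ with hddef
  set e := X z₀ - q with he
  -- Chosen so that `K (3L)² = d/8`: curve points near boundary values within `L` of `X z₀` lie
  -- within `3L` of `q`, and contribute height at most `d²/8`. The tube radius `r₁ ≤ d/8`
  -- contributes as much again.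
  set L := Real.sqrt (d / (72 * K)) with hLdef
  have hL2 : L ^ 2 = d / (72 * K) := Real.sq_sqrt (by positivity)
  have hL : 0 < L := Real.sqrt_pos.2 (by positivity)
  have hKL : K * L ^ 2 = d / 72 := by rw [hL2]; field_simp
  have hdL : d ≤ L := by
    refine Real.le_sqrt_of_sq_le ?_
    rw [div_eq_mul_one_div, sq]
    exact mul_le_mul_of_nonneg_left hd₀ hd.le
  have hlow : ∀ w ∈ sphere (0 : ℂ) 1, ‖X w - X z₀‖ ≤ L → inner ℝ e (X w - q) ≤ d ^ 2 / 4 := by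
    intro w hw hwL
    obtain ⟨t, ht, htr⟩ := hb w hw
    have h1 : ‖Γ t - q‖ ≤ 3 * L := by
      have h2 : Γ t - q = -(X w - Γ t) + (X w - X z₀) + e := by rw [he]; abel
      rw [h2]
      refine (norm_add₃_le).trans ?_
      rw [norm_neg]
      linarith
    have h3 : inner ℝ e (X w - q) = inner ℝ e (X w - Γ t) + inner ℝ e (Γ t - q) := by
      rw [← inner_add_right]; congr 1; abel
    have h4 := real_inner_le_norm e (X w - Γ t)
    have h5 : K * ‖Γ t - q‖ ^ 2 ≤ d / 8 := by
      have := pow_le_pow_left₀ (norm_nonneg _) h1 2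
      calc K * ‖Γ t - q‖ ^ 2 ≤ K * (3 * L) ^ 2 := mul_le_mul_of_nonneg_left this hK.le
        _ = 9 * (K * L ^ 2) := by ring
        _ = d / 8 := by rw [hKL]; ring
    have h6 := (hq t ht).trans (mul_le_mul_of_nonneg_left h5 hd.le)
    have h7 : ‖e‖ * ‖X w - Γ t‖ ≤ d * (d / 8) :=
      mul_le_mul hddef.ge (by linarith) (norm_nonneg _) hd.le
    rw [h3]
    nlinarith
  have hhigh : ∀ k : ℕ, k * (d / 2) ≤ L → ∃ z ∈ ball (0 : ℂ) 1, d ^ 2 ≤ inner ℝ e (X z - q) ∧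
      ‖X z - X z₀‖ = k * (d / 2) := by
    intro k hk
    obtain ⟨z, hz, h1, h2, h3⟩ := exists_ge_of_harmonic (t := k * (d / 2))
      (hX.continuousOn_inner q e) (hX.continuousOn_norm_sub (X z₀)) (hX.harmonicOnNhd_inner q e) hz₀
      (by simp; positivity)
    have h4 : d ^ 2 ≤ inner ℝ e (X z - q) := by
      rw [← real_inner_self_eq_norm_sq]
      exact h1
    have h5 : z ∉ sphere (0 : ℂ) 1 := fun hzs => by
      have := hlow z hzs (h2.trans hk)
      nlinarith
    refine ⟨z, ?_, h4, h3.resolve_right h5⟩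
    exact mem_ball.2 (lt_of_le_of_ne hz h5)
  -- The steps `k d/2`, `k < N`, use only half of the range `L`, so the balls of radius `d/4` stay
  -- within `L` of `X z₀`. There the height drop from `d²` to `d²/4` separates their centres from
  -- the boundary values.
  set N := ⌈L / d⌉₊ with hN
  have hk : ∀ k < N, (k : ℝ) * (d / 2) + d / 4 ≤ L := by
    intro k hk
    have h1 : (k : ℝ) * d < L := (lt_div_iff₀ hd).1 (Nat.lt_ceil.1 hk)
    linarith
  have hch : ∀ k : ℕ, ∃ z, k < N → z ∈ ball (0 : ℂ) 1 ∧ d ^ 2 ≤ inner ℝ e (X z - q) ∧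
      ‖X z - X z₀‖ = k * (d / 2) := by
    intro k
    by_cases h : k < N
    · obtain ⟨z, h1, h2, h3⟩ := hhigh k (by linarith [hk k h])
      exact ⟨z, fun _ => ⟨h1, h2, h3⟩⟩
    · exact ⟨0, fun h' => absurd h' h⟩
  choose ζ hζ using hch
  have hmain := hX.card_mul_le_dirichletEnergy (R := d / 4) (N := N) (ζ := ζ) (by positivity)
    (fun k hkN => (hζ k hkN).1) ?_ ?_
  · have h1 := (ENNReal.ofReal_le_ofReal_iff hα.le).1 (hmain.trans hE)
    have h2 : L / d ≤ N := Nat.le_ceil _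
    have h3 : L / d * ((d / 4) ^ 2 / 3200) ≤ α :=
      (mul_le_mul_of_nonneg_right h2 (by positivity)).trans h1
    have h4 : L / d * ((d / 4) ^ 2 / 3200) = L * d / 51200 := by field_simp; norm_num
    have h5 : L * d ≤ 51200 * α := by linarith
    have h6 := pow_le_pow_left₀ (by positivity) h5 2
    have h7 : d ^ 3 = 72 * K * (L * d) ^ 2 := by
      rw [mul_pow, hL2]; field_simp
    rw [h7]
    exact mul_le_mul_of_nonneg_left h6 (by positivity)
  · intro k hkN w hw
    obtain ⟨h1, h2, h3⟩ := hζ k hkN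
    rcases le_or_gt ‖X w - X z₀‖ L with h | h
    · have h4 := hlow w hw h
      have h5 : inner ℝ e (X (ζ k) - X w) = inner ℝ e (X (ζ k) - q) - inner ℝ e (X w - q) := by
        rw [← inner_sub_right]; congr 1; abel
      have h6 := real_inner_le_norm e (X (ζ k) - X w)
      rw [norm_sub_rev]
      nlinarith
    · have h4 := norm_sub_le_norm_sub_add_norm_sub (X w) (X (ζ k)) (X z₀)
      have h5 := hk k hkN
      linarith
  · intro j hj k hkN hjk
    obtain ⟨-, -, h1⟩ := hζ j hj
    obtain ⟨-, -, h2⟩ := hζ k hkN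
    have h3 := abs_norm_sub_norm_le (X (ζ j) - X z₀) (X (ζ k) - X z₀)
    rw [sub_sub_sub_cancel_right, h1, h2, ← sub_mul, abs_mul, abs_of_pos (half_pos hd)] at h3
    have h4 : (1 : ℝ) ≤ |(j : ℝ) - k| := by
      have : (1 : ℤ) ≤ |(j : ℤ) - k| := Int.one_le_abs (sub_ne_zero.2 (by exact_mod_cast hjk))
      exact_mod_cast this
    nlinarith

end IsConformalHarmonicDisc

/-! ### From distance bounds to tubes -/

namespace IsArclengthEmbeddedC2

variable {ℓ : ℝ} {Γ : ℝ → Space3}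

/-- The distance bound for the metric tube, without smallness assumptions. -/
theorem exists_infDist_le (hΓ : IsArclengthEmbeddedC2 ℓ Γ) :
    ∃ C₁ C₂ : ℝ, 1 ≤ C₁ ∧ 0 < C₂ ∧ ∀ r₁ α : ℝ, 0 ≤ r₁ → 0 < α →
      ∀ X : ℂ → Space3, IsConformalHarmonicDisc X → X '' sphere 0 1 ⊆ metricTube ℓ Γ r₁ →
        dirichletEnergy X ≤ ENNReal.ofReal α → ∀ z ∈ closedBall (0 : ℂ) 1,
          infDist (X z) (Γ '' Icc 0 ℓ) ≤ C₁ * r₁ + C₂ * α ^ (2 / 3 : ℝ) := by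
  obtain ⟨K, hK, hquad⟩ := hΓ.exists_inner_le_sq
  have hℓ := hΓ.length_pos
  have h0mem : (0 : ℝ) ∈ Icc 0 ℓ := ⟨le_rfl, hℓ.le⟩
  set A := 72 * K * 51200 ^ 2 with hA
  set d₀ := 1 / (72 * K) with hd₀
  have hA0 : 0 < A := by positivity
  have hd₀0 : 0 < d₀ := by positivity
  -- If `d ≥ d₀`, then `d₀ ≤ 8r₁ + (A+1)α^(2/3)`, and the crude bound `d ≤ r₁ + ℓ` is absorbed by
  -- multiplying with `ℓ/d₀`. `A + 1` replaces the cube root of `A`.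
  refine ⟨9 + 8 * (ℓ / d₀), (A + 1) * (1 + ℓ / d₀), ?_, by positivity, ?_⟩
  · have : 0 ≤ 8 * (ℓ / d₀) := by positivity
    linarith
  intro r₁ α hr₁ hα X hX hb hE z hz
  have hb' : ∀ w ∈ sphere (0 : ℂ) 1, ∃ t ∈ Icc 0 ℓ, ‖X w - Γ t‖ ≤ r₁ := fun w hw =>
    (hΓ.mem_metricTube_iff hr₁).1 (hb (mem_image_of_mem X hw))
  set a := α ^ (2 / 3 : ℝ) with ha
  have ha0 : 0 < a := Real.rpow_pos_of_pos hα _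
  have ha3 : a ^ 3 = α ^ 2 := by
    rw [ha, ← Real.rpow_natCast, ← Real.rpow_mul hα.le, ← Real.rpow_natCast]
    norm_num
  set d := infDist (X z) (Γ '' Icc 0 ℓ) with hd
  -- The local estimate needs distance at most `d₀`; by continuity some `z₀` has distance exactly
  -- `min d d₀`.
  have hsmall : min d d₀ ≤ 8 * r₁ + (A + 1) * a := by
    by_contra! hlt
    have hpos : 0 < min d d₀ := lt_of_le_of_lt (by positivity) hlt
    have hcont : ContinuousOn (fun z => infDist (X z) (Γ '' Icc 0 ℓ)) (closedBall (0 : ℂ) 1) :=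
      (continuous_infDist_pt _).comp_continuousOn hX.continuousOn
    obtain ⟨t, ht, htr⟩ := hb' 1 (by simp)
    have h1 : infDist (X 1) (Γ '' Icc 0 ℓ) ≤ min d d₀ := by
      have h2 := infDist_le_dist_of_mem (x := X 1) (mem_image_of_mem Γ ht)
      rw [dist_eq_norm] at h2
      have h3 : 0 < (A + 1) * a := by positivity
      linarith
    obtain ⟨z₀, hz₀, hz₀d⟩ := (convex_closedBall (0 : ℂ) 1).isPreconnected.intermediate_value
      (show (1 : ℂ) ∈ closedBall (0 : ℂ) 1 by simp) hz hcont ⟨h1, min_le_left d d₀⟩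
    obtain ⟨s, hs, hmin, hsd⟩ := hΓ.exists_nearest (X z₀)
    have h4 : ‖X z₀ - Γ s‖ = min d d₀ := by rw [← hsd]; exact hz₀d
    have h5 : 0 < (A + 1) * a := by positivity
    have h6 := hX.dist_pow_three_le hK hα hb' hE hz₀ (q := Γ s) (by rw [h4]; exact hpos)
      (by rw [h4]; linarith) (by rw [h4]; exact min_le_right _ _) (hquad _ s hs hmin)
    rw [h4] at h6
    have h7 : ((A + 1) * a) ^ 3 < (min d d₀) ^ 3 :=
      pow_lt_pow_left₀ (by linarith) h5.le (by norm_num)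
    rw [mul_pow, ha3] at h7
    have h8 : A * α ^ 2 ≤ (A + 1) ^ 3 * α ^ 2 :=
      mul_le_mul_of_nonneg_right (by nlinarith [pow_pos hA0 2, pow_pos hA0 3]) (sq_nonneg α)
    have h9 : 72 * K * (51200 * α) ^ 2 = A * α ^ 2 := by rw [hA]; ring
    linarith
  have hq : 0 ≤ ℓ / d₀ := by positivity
  rcases le_total d d₀ with h | h
  · rw [min_eq_left h] at hsmall
    nlinarith [mul_nonneg hq hr₁, mul_nonneg hq (mul_pos (show 0 < A + 1 by linarith) ha0).le]
  · rw [min_eq_right h] at hsmall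
    have h1 : ‖X z - Γ 0‖ ≤ r₁ + ℓ := hX.norm_sub_le_of_sphere (fun w hw => by
      obtain ⟨t, ht, htr⟩ := hb' w hw
      have h2 := hΓ.norm_sub_le ht h0mem
      rw [sub_zero, abs_of_nonneg ht.1] at h2
      have h3 := norm_sub_le_norm_sub_add_norm_sub (X w) (Γ t) (Γ 0)
      linarith [ht.2]) hz
    have h2 : d ≤ ‖X z - Γ 0‖ := by
      rw [← dist_eq_norm]
      exact infDist_le_dist_of_mem (mem_image_of_mem Γ h0mem)
    have h3 := mul_le_mul_of_nonneg_left hsmall hq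
    rw [div_mul_cancel₀ _ hd₀0.ne'] at h3
    have h5 : 0 < (A + 1) * a := by positivity
    linarith

/-- Near an end point `Γ e`, a conformal harmonic disc with boundary in a thin normal tube stays in
the half-space bounded by the normal plane there. The sign `σ` directs the tangent inwards. -/
theorem exists_halfSpace (hΓ : IsArclengthEmbeddedC2 ℓ Γ) :
    ∃ δ : ℝ, 0 < δ ∧ ∀ r₁ r₂ : ℝ, r₁ ≤ δ → 0 ≤ r₂ → r₂ ≤ δ →
      ∀ X : ℂ → Space3, IsConformalHarmonicDisc X → X '' sphere 0 1 ⊆ normalTube ℓ Γ r₁ →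
        (∀ z ∈ closedBall (0 : ℂ) 1, X z ∈ metricTube ℓ Γ r₂) →
        ∀ e ∈ Icc 0 ℓ, ∀ σ : ℝ, |σ| = 1 → (∀ s ∈ Icc 0 ℓ, 0 ≤ σ * (s - e)) →
          ∀ z ∈ closedBall (0 : ℂ) 1, ‖X z - Γ e‖ ≤ δ →
            0 ≤ σ * inner ℝ (X z - Γ e) (derivWithin Γ (Icc 0 ℓ) e) := by
  obtain ⟨M, hM, hLip⟩ := hΓ.exists_lipschitz_tangent
  obtain ⟨c, hc, hca⟩ := hΓ.exists_chord_arc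
  set ρ := 1 / (8 * M * (c + 1)) with hρ
  have hρ0 : 0 < ρ := by positivity
  have hMρ : M * ρ * (c + 1) = 1 / 8 := by rw [hρ]; field_simp
  refine ⟨ρ / 4, by positivity, ?_⟩
  intro r₁ r₂ hr₁ hr₂0 hr₂ X hX hb hT e he σ hσ hin z₀ hz₀ hz₀ρ
  have hMρ1 : M * ρ ≤ 1 / 8 := by nlinarith [mul_pos hM hρ0]
  have hcρ1 : M * (c * ρ) ≤ 1 / 8 := by nlinarith [mul_pos hM hρ0]
  have habs : ∀ s ∈ Icc 0 ℓ, |s - e| = σ * (s - e) := by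
    intro s hs
    rw [← abs_of_nonneg (hin s hs), abs_mul, hσ, one_mul]
  have hcurve : ∀ s ∈ Icc 0 ℓ, |s - e| - M * |s - e| ^ 2 ≤
      σ * inner ℝ (Γ s - Γ e) (derivWithin Γ (Icc 0 ℓ) e) := by
    intro s hs
    set T := derivWithin Γ (Icc 0 ℓ) e with hTdef
    have hT1 : ‖T‖ = 1 := hΓ.unit_speed e he
    have h1 := hΓ.norm_sub_sub_smul_le hM hLip hs he
    have h2 : inner ℝ (Γ s - Γ e) T = (s - e) + inner ℝ (Γ s - Γ e - (s - e) • T) T := by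
      rw [inner_sub_left (Γ s - Γ e), inner_smul_left, real_inner_self_eq_norm_sq, hT1]
      simp
    have h3 := abs_real_inner_le_norm (Γ s - Γ e - (s - e) • T) T
    rw [hT1, mul_one] at h3
    have h4 := neg_abs_le (σ * inner ℝ (Γ s - Γ e - (s - e) • T) T)
    rw [abs_mul, hσ, one_mul] at h4
    rw [h2, mul_add, ← habs s hs]
    linarith
  by_contra! hneg
  have huc : ContinuousOn (fun z => inner ℝ (-σ • derivWithin Γ (Icc 0 ℓ) e) (X z - Γ e))
      (closedBall 0 1) := hX.continuousOn_inner _ _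
  obtain ⟨z, hz, h1, h2, h3⟩ := exists_ge_of_harmonic (t := ρ) huc
    (hX.continuousOn_norm_sub (Γ e)) (hX.harmonicOnNhd_inner _ _) hz₀
    (show ‖X z₀ - Γ e‖ ≤ ρ by linarith)
  have hswap : ∀ y, inner ℝ (-σ • derivWithin Γ (Icc 0 ℓ) e) (X y - Γ e) =
      -(σ * inner ℝ (X y - Γ e) (derivWithin Γ (Icc 0 ℓ) e)) := by
    intro y
    rw [inner_smul_left, real_inner_comm]
    simp
  simp only [hswap] at h1
  have hzneg : σ * inner ℝ (X z - Γ e) (derivWithin Γ (Icc 0 ℓ) e) < 0 := by linarith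
  -- At distance `ρ`: the nearby curve point has height less than `r₂`, so `|s - e| ≤ 2r₂`, and `X
  -- z` is within `3r₂ < ρ` of `Γ e`. On the boundary: `X z` lies in a normal disc at `Γ s`, whose
  -- tilt costs less height than the curve gains.
  rcases h3 with h3 | h3
  · obtain ⟨s, hs, hsr⟩ := (hΓ.mem_metricTube_iff hr₂0).1 (hT z hz)
    have h4 : ‖Γ s - Γ e‖ ≤ ρ + r₂ := by
      have := norm_sub_le_norm_sub_add_norm_sub (Γ s) (X z) (Γ e)
      rw [norm_sub_rev (Γ s) (X z)] at this
      linarith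
    have h5 : |s - e| ≤ c * (5 / 4 * ρ) :=
      (hca s hs e he).trans (mul_le_mul_of_nonneg_left (by linarith) hc.le)
    have h6 := hcurve s hs
    have h7 : M * |s - e| ≤ 1 / 2 := by
      have := mul_le_mul_of_nonneg_left h5 hM.le
      linarith
    have h8 : inner ℝ (Γ s - Γ e) (derivWithin Γ (Icc 0 ℓ) e) =
        inner ℝ (X z - Γ e) (derivWithin Γ (Icc 0 ℓ) e) -
          inner ℝ (X z - Γ s) (derivWithin Γ (Icc 0 ℓ) e) := by
      rw [← inner_sub_left]; congr 1; abel
    have h9 := abs_real_inner_le_norm (X z - Γ s) (derivWithin Γ (Icc 0 ℓ) e)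
    rw [hΓ.unit_speed e he, mul_one] at h9
    have h10 := neg_abs_le (σ * inner ℝ (X z - Γ s) (derivWithin Γ (Icc 0 ℓ) e))
    rw [abs_mul, hσ, one_mul] at h10
    rw [h8, mul_sub] at h6
    have h11 : |s - e| ≤ 2 * r₂ := by nlinarith [abs_nonneg (s - e)]
    have h12 := norm_sub_le_norm_sub_add_norm_sub (X z) (Γ s) (Γ e)
    have h13 := hΓ.norm_sub_le hs he
    linarith
  · obtain ⟨s, hs, horth, hsr⟩ := mem_iUnion₂.1 (hb (mem_image_of_mem X h3))
    have h4 : ‖Γ s - Γ e‖ ≤ ρ + r₁ := by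
      have := norm_sub_le_norm_sub_add_norm_sub (Γ s) (X z) (Γ e)
      rw [norm_sub_rev (Γ s) (X z)] at this
      linarith
    have h5 : |s - e| ≤ c * (5 / 4 * ρ) :=
      (hca s hs e he).trans (mul_le_mul_of_nonneg_left (by linarith) hc.le)
    have h6 := hcurve s hs
    have h7 := mul_le_mul_of_nonneg_left h5 hM.le
    have h8 : inner ℝ (X z - Γ e) (derivWithin Γ (Icc 0 ℓ) e) =
        inner ℝ (Γ s - Γ e) (derivWithin Γ (Icc 0 ℓ) e) +
          inner ℝ (X z - Γ s) (derivWithin Γ (Icc 0 ℓ) e - derivWithin Γ (Icc 0 ℓ) s) := by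
      rw [inner_sub_right, horth, sub_zero, ← inner_add_left]; congr 1; abel
    have h9 := abs_real_inner_le_norm (X z - Γ s)
      (derivWithin Γ (Icc 0 ℓ) e - derivWithin Γ (Icc 0 ℓ) s)
    have h10 := neg_abs_le (σ * inner ℝ (X z - Γ s)
      (derivWithin Γ (Icc 0 ℓ) e - derivWithin Γ (Icc 0 ℓ) s))
    rw [abs_mul, hσ, one_mul] at h10
    have h11 := hLip e he s hs
    rw [abs_sub_comm e s] at h11
    have h12 : ‖X z - Γ s‖ * ‖derivWithin Γ (Icc 0 ℓ) e - derivWithin Γ (Icc 0 ℓ) s‖ ≤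
        ρ / 4 * (M * |s - e|) :=
      mul_le_mul (hsr.trans hr₁) h11 (norm_nonneg _) (by positivity)
    rw [h8, mul_add] at hzneg
    have h13 : 0 ≤ |s - e| * (1 - M * |s - e| - M * ρ / 4) :=
      mul_nonneg (abs_nonneg _) (by linarith)
    nlinarith

/-- A point of the metric tube on the inner side of both end planes lies in the normal tube. -/
theorem mem_normalTube_of_halfSpace (hΓ : IsArclengthEmbeddedC2 ℓ Γ) {r : ℝ} {x : Space3}
    (hr : infDist x (Γ '' Icc 0 ℓ) ≤ r)
    (hend : ∀ e ∈ Icc 0 ℓ, ∀ σ : ℝ, |σ| = 1 → (∀ s ∈ Icc 0 ℓ, 0 ≤ σ * (s - e)) →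
      ‖x - Γ e‖ ≤ r → 0 ≤ σ * inner ℝ (x - Γ e) (derivWithin Γ (Icc 0 ℓ) e)) :
    x ∈ normalTube ℓ Γ r := by
  have hℓ := hΓ.length_pos
  obtain ⟨s, hs, hmin, hsd⟩ := hΓ.exists_nearest x
  rw [hsd] at hr
  refine mem_iUnion₂.2 ⟨s, hs, ?_, hr⟩
  -- Testing against both ends gives orthogonality at an interior parameter; at an end point `hend`
  -- supplies the missing inequality.
  have h0 := hΓ.inner_tangent_mul_nonpos hs hmin (t := 0) ⟨le_rfl, hℓ.le⟩
  have h1 := hΓ.inner_tangent_mul_nonpos hs hmin (t := ℓ) ⟨hℓ.le, le_rfl⟩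
  refine le_antisymm ?_ ?_
  · rcases hs.2.lt_or_eq with h | h
    · by_contra! hpos
      nlinarith [mul_pos (sub_pos.2 h) hpos]
    · have := hend s hs (-1) (by norm_num) (fun t ht => by linarith [ht.2]) hr
      linarith
  · rcases hs.1.lt_or_eq with h | h
    · by_contra! hneg
      nlinarith [mul_pos_of_neg_of_neg (show 0 - s < 0 by linarith) hneg]
    · have := hend s hs 1 (by norm_num) (fun t ht => by linarith [ht.1]) hr
      linarith

theorem normalTube_subset_metricTube (hΓ : IsArclengthEmbeddedC2 ℓ Γ) {r : ℝ} (hr : 0 ≤ r) :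
    normalTube ℓ Γ r ⊆ metricTube ℓ Γ r := by
  intro x hx
  obtain ⟨s, hs, -, hsr⟩ := mem_iUnion₂.1 hx
  exact (hΓ.mem_metricTube_iff hr).2 ⟨s, hs, hsr⟩

theorem mem_metricTube_of_infDist_le (hΓ : IsArclengthEmbeddedC2 ℓ Γ) {r : ℝ} {x : Space3}
    (h : infDist x (Γ '' Icc 0 ℓ) ≤ r) : x ∈ metricTube ℓ Γ r := by
  obtain ⟨s, hs, -, hsd⟩ := hΓ.exists_nearest x
  exact (hΓ.mem_metricTube_iff (infDist_nonneg.trans h)).2 ⟨s, hs, hsd ▸ h⟩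

end IsArclengthEmbeddedC2

/-! ### Conclusion -/

theorem mainTheorem6 (ℓ : ℝ) (Γ : ℝ → Space3) (hΓ : IsArclengthEmbeddedC2 ℓ Γ) :
    ∃ (C₁ C₂ : ℝ) (ω : ℝ → ℝ), 0 < C₁ ∧ 0 < C₂ ∧
      Asymptotics.IsLittleO (𝓝[>] (0 : ℝ)) ω (fun α : ℝ => α ^ (2 / 3 : ℝ)) ∧
      (∃ ε : ℝ, 0 < ε ∧ ∀ (r₁ α : ℝ), 0 ≤ r₁ → r₁ ≤ ε → 0 < α → α ≤ ε →
        ∀ X : ℂ → Space3, IsConformalHarmonicDisc X →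
          X '' sphere 0 1 ⊆ normalTube ℓ Γ r₁ →
          dirichletEnergy X ≤ ENNReal.ofReal α →
          X '' closedBall 0 1 ⊆ normalTube ℓ Γ (C₁ * r₁ + C₂ * α ^ (2 / 3 : ℝ) + ω α)) ∧
      (∀ (r₁ α : ℝ), 0 ≤ r₁ → 0 < α →
        ∀ X : ℂ → Space3, IsConformalHarmonicDisc X →
          X '' sphere 0 1 ⊆ metricTube ℓ Γ r₁ →
          dirichletEnergy X ≤ ENNReal.ofReal α →
          X '' closedBall 0 1 ⊆ metricTube ℓ Γ (C₁ * r₁ + C₂ * α ^ (2 / 3 : ℝ) + ω α)) := by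
  obtain ⟨C₁, C₂, hC₁, hC₂, hdist⟩ := hΓ.exists_infDist_le
  obtain ⟨δ, hδ, hhalf⟩ := hΓ.exists_halfSpace
  have hC₁0 : 0 < C₁ := one_pos.trans_le hC₁
  -- The estimate holds for all `α > 0` with a pure power, so no error term is needed.
  refine ⟨C₁, C₂, fun _ => 0, hC₁0, hC₂, Asymptotics.isLittleO_zero _ _, ?_, ?_⟩
  · set η := min 1 (δ / (C₁ + C₂)) with hη
    have hη0 : 0 < η := by positivity
    have hη1 : η ≤ 1 := min_le_left _ _
    have hηδ : η * (C₁ + C₂) ≤ δ := (le_div_iff₀ (by positivity)).1 (min_le_right _ _)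
    -- The cube makes `α^(2/3) ≤ η² ≤ η`, so the final radius is at most `η(C₁ + C₂) ≤ δ`.
    refine ⟨η ^ 3, by positivity, ?_⟩
    rintro r₁ α hr₁ hr₁ε hα hαε X hX hb hE _ ⟨z, hz, rfl⟩
    have hη3 : η ^ 3 ≤ η := by nlinarith [mul_nonneg hη0.le (sub_nonneg.2 hη1), sq_nonneg η]
    have hpow : α ^ (2 / 3 : ℝ) ≤ η := by
      calc α ^ (2 / 3 : ℝ) ≤ (η ^ 3) ^ (2 / 3 : ℝ) :=
            Real.rpow_le_rpow hα.le hαε (by norm_num)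
        _ = η ^ 2 := by
            rw [← Real.rpow_natCast, ← Real.rpow_mul hη0.le, ← Real.rpow_natCast]
            norm_num
        _ ≤ η := by nlinarith
    have hr₂ : C₁ * r₁ + C₂ * α ^ (2 / 3 : ℝ) ≤ δ := by
      have h1 := mul_le_mul_of_nonneg_left (hr₁ε.trans hη3) hC₁0.le
      have h2 := mul_le_mul_of_nonneg_left hpow hC₂.le
      linarith
    have hr₂0 : 0 ≤ C₁ * r₁ + C₂ * α ^ (2 / 3 : ℝ) := by positivity
    have hr₁δ : r₁ ≤ δ := by
      have h1 : 0 ≤ C₂ * α ^ (2 / 3 : ℝ) := by positivity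
      have h2 : r₁ ≤ C₁ * r₁ := le_mul_of_one_le_left hr₁ hC₁
      linarith
    have hall := hdist r₁ α hr₁ hα X hX (hb.trans (hΓ.normalTube_subset_metricTube hr₁)) hE
    rw [add_zero]
    refine hΓ.mem_normalTube_of_halfSpace (hall z hz) fun e he σ hσ hin hle => ?_
    exact hhalf r₁ _ hr₁δ hr₂0 hr₂ X hX hb
      (fun y hy => hΓ.mem_metricTube_of_infDist_le (hall y hy)) e he σ hσ hin z hz (hle.trans hr₂)
  · rintro r₁ α hr₁ hα X hX hb hE _ ⟨z, hz, rfl⟩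
    rw [add_zero]
    exact hΓ.mem_metricTube_of_infDist_le (hdist r₁ α hr₁ hα X hX hb hE z hz)
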